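/- Let $T>0$ and $\Omega=[0,1]\times[0,T]$. A function $f$ on $\Omega$ is called completely continuous if it is absolutely continuous in the sense of Carathéodory, i.e. $f(x,t)=f(0,0)+\int_0^x a+\int_0^t b+\int_0^x\!\int_0^t h$ with integrable $a,b,h$. Let $W(\Omega)$ be the space of functions $u$ on $\Omega$ for which $\partial_x^2\partial_t^2u$ exists and is completely continuous, $\partial_x^3\partial_t^3u\in L^2(\Omega)$, $u(x,0)=\partial_tu(x,0)=u(0,t)=u(1,t)=0$, and all terms of the following inner product are finite: $$\langle u,g\rangle_W=\sum_{i=0}^2\int_0^T\partial_t^3\partial_x^iu(0,t)\,\partial_t^3\partial_x^ig(0,t)\,dt+\sum_{j=0}^2\big\langle\partial_t^ju(\cdot,0),\partial_t^jg(\cdot,0)\big\rangle_{W_2^3}+\int_0^1\!\!\int_0^T\partial_x^3\partial_t^3u\,\partial_x^3\partial_t^3g\,dt\,dx,$$ where $\langle v,w\rangle_{W_2^3}=v(0)w(0)+v'(0)w'(0)+v'(1)w'(1)+\int_0^1v'''w'''\,dx$. Let $\widehat W(\Omega)$ be the space of completely continuous functions $f$ on $\Omega$ with $\partial_x\partial_tf\in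 L^2(\Omega)$, $\partial_t f(0,\cdot)\in L^2[0,T]$, $\partial_xf(\cdot,0)\in L^2[0,1]$, with inner product $$\langle f,g\rangle_{\widehat W}=\int_0^T\partial_tf(0,t)\,\partial_tg(0,t)\,dt+f(0,0)g(0,0)+\int_0^1\partial_xf(x,0)\,\partial_xg(x,0)\,dx+\int_0^1\!\!\int_0^T\partial_x\partial_tf\,\partial_x\partial_tg\,dt\,dx$$ and reproducing kernel $G_{(y,s)}(x,t)=(1+\min(x,y))(1+\min(t,s))$. Let $L:W(\Omega)\to\widehat W(\Omega)$, $Lv=\partial_t^2v-\partial_x^2v$, with adjoint $L^*$. Let $M:\Omega\times\mathbb R\to\mathbb R$ be continuous, and consider the homogenized sine-Gordon problem $$Lv(x,t)=M(x,t,v(x,t))\quad\text{on }\Omega,\qquad v(x,0)=\partial_tv(x,0)=v(0,t)=v(1,t)=0.\tag{1}$$ Let $(x_1,t_1),(x_2,t_2),\dots$ be distinct points of $\Omega$ that are dense in $\Omega$. Put $\varphi_i=G_{(x_i,t_i)}$ and $\Psi_i=L^*\varphi_i$, let $(\widehat\Psi_i)$ be obtained from $(\Psi_i)$ by Gram–Schmidt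 orthonormalization in $W(\Omega)$ (with $\widehat\Psi_i=0$ if $\Psi_i$ lies in the span of its predecessors), and let $\beta_{ik}$ be coefficients with $\widehat\Psi_i=\sum_{k=1}^i\beta_{ik}\Psi_k$. Put $u_0=0$ and $$u_n=\sum_{i=1}^nB_i\widehat\Psi_i,\qquad B_i=\sum_{k=1}^i\beta_{ik}\,M\big(x_k,t_k,u_{k-1}(x_k,t_k)\big).$$ Suppose that (1) has a unique solution $u$ in $W(\Omega)$. Then $L$ maps $W(\Omega)$ into $\widehat W(\Omega)$ and all the objects above exist. If moreover the norms $\|u_n\|_W$ are bounded, then $u_n\to u$ in $W(\Omega)$ and uniformly on $\Omega$, and $$u=\sum_{i=1}^\infty B_i\widehat\Psi_i,$$ where the series converges (unconditionally) in $W(\Omega)$ and at each point of $\Omega$. -/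

import Mathlib

open Set Filter Topology MeasureTheory

namespace SineGordon

noncomputable section

/-- The rectangle `Ω = [0,1] × [0,T]`. Functions on `Ω` are written as functions
`u : ℝ → ℝ → ℝ`, `u x t`, of which only the values on `Ω` matter. -/
def Omega (T : ℝ) : Set (ℝ × ℝ) := Icc 0 1 ×ˢ Icc 0 T

/-- `∂u/∂x` on `[0,1]` (one-sided at the end points). -/
def dx (u : ℝ → ℝ → ℝ) : ℝ → ℝ → ℝ :=
  fun x t => derivWithin (fun y => u y t) (Icc 0 1) x

/-- `∂u/∂t` on `[0,T]` (one-sided at the end points). -/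
def dt (T : ℝ) (u : ℝ → ℝ → ℝ) : ℝ → ℝ → ℝ :=
  fun x t => derivWithin (fun s => u x s) (Icc 0 T) t

/-- `∂^{i+j} u / ∂x^i ∂t^j`. -/
def D (T : ℝ) (i j : ℕ) (u : ℝ → ℝ → ℝ) : ℝ → ℝ → ℝ := dx^[i] ((dt T)^[j] u)

/-- Complete (= absolute) continuity on the rectangle, in the sense of Carathéodory:
`f(x,t) = f(0,0) + ∫₀ˣ a + ∫₀ᵗ b + ∫₀ˣ∫₀ᵗ h` with integrable `a`, `b`, `h`. For such `f`,
almost everywhere `a = ∂f/∂x(·,0)`, `b = ∂f/∂t(0,·)` and `h = ∂²f/∂x∂t`. -/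
def CompletelyContinuous (T : ℝ) (f : ℝ → ℝ → ℝ) : Prop :=
  ∃ (a b : ℝ → ℝ) (h : ℝ → ℝ → ℝ),
    IntegrableOn a (Icc 0 1) ∧ IntegrableOn b (Icc 0 T) ∧
    IntegrableOn (fun q : ℝ × ℝ => h q.1 q.2) (Omega T) ∧
    ∀ x ∈ Icc (0 : ℝ) 1, ∀ t ∈ Icc (0 : ℝ) T,
      f x t = f 0 0 + (∫ ξ in (0 : ℝ)..x, a ξ) + (∫ τ in (0 : ℝ)..t, b τ)
        + ∫ ξ in (0 : ℝ)..x, ∫ τ in (0 : ℝ)..t, h ξ τ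

/-- The inner product of `W₂³[0,1]`. -/
def inner3 (v w : ℝ → ℝ) : ℝ :=
  v 0 * w 0 + derivWithin v (Icc 0 1) 0 * derivWithin w (Icc 0 1) 0
    + derivWithin v (Icc 0 1) 1 * derivWithin w (Icc 0 1) 1
    + ∫ x in (0 : ℝ)..1, iteratedDerivWithin 3 v (Icc 0 1) x * iteratedDerivWithin 3 w (Icc 0 1) x

/-- The inner product of `W₂¹[0,1]`. -/
def inner1 (v w : ℝ → ℝ) : ℝ :=
  v 0 * w 0 + ∫ x in (0 : ℝ)..1, derivWithin v (Icc 0 1) x * derivWithin w (Icc 0 1) x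

/-- Membership in `W(Ω)`: `∂⁴u/∂x²∂t²` exists and is completely continuous, `∂⁶u/∂x³∂t³` is
square integrable, the terms of the inner product are finite, and
`u(x,0) = ∂u/∂t(x,0) = u(0,t) = u(1,t) = 0`. -/
structure MemW (T : ℝ) (u : ℝ → ℝ → ℝ) : Prop where
  diff_t : ∀ j < 2, ∀ x ∈ Icc (0 : ℝ) 1, ∀ t ∈ Icc (0 : ℝ) T,
    DifferentiableWithinAt ℝ (fun s => D T 0 j u x s) (Icc 0 T) t
  diff_x : ∀ i < 2, ∀ j ≤ 2, ∀ x ∈ Icc (0 : ℝ) 1, ∀ t ∈ Icc (0 : ℝ) T,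
    DifferentiableWithinAt ℝ (fun y => D T i j u y t) (Icc 0 1) x
  completelyContinuous : CompletelyContinuous T (D T 2 2 u)
  memLp_top : MemLp (fun q : ℝ × ℝ => dx (dt T (D T 2 2 u)) q.1 q.2) 2 (volume.restrict (Omega T))
  memLp_left : ∀ i ≤ 2, MemLp (fun t => dt T (D T i 2 u) 0 t) 2 (volume.restrict (Icc 0 T))
  memLp_bottom : ∀ j ≤ 2,
    MemLp (iteratedDerivWithin 3 (fun x => D T 0 j u x 0) (Icc 0 1)) 2 (volume.restrict (Icc 0 1))
  initial : ∀ x ∈ Icc (0 : ℝ) 1, u x 0 = 0 ∧ dt T u x 0 = 0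
  boundary : ∀ t ∈ Icc (0 : ℝ) T, u 0 t = 0 ∧ u 1 t = 0

/-- The inner product of `W(Ω)`. -/
def innerW (T : ℝ) (u g : ℝ → ℝ → ℝ) : ℝ :=
  (∑ i ∈ Finset.range 3, ∫ t in (0 : ℝ)..T, dt T (D T i 2 u) 0 t * dt T (D T i 2 g) 0 t)
    + (∑ j ∈ Finset.range 3, inner3 (fun x => D T 0 j u x 0) (fun x => D T 0 j g x 0))
    + ∫ x in (0 : ℝ)..1, ∫ t in (0 : ℝ)..T,
        dx (dt T (D T 2 2 u)) x t * dx (dt T (D T 2 2 g)) x t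

/-- The norm of `W(Ω)`. -/
def normW (T : ℝ) (u : ℝ → ℝ → ℝ) : ℝ := √(innerW T u u)

/-- Membership in `Ŵ(Ω)`: complete continuity, square integrable `∂²f/∂x∂t`, and finiteness of
the terms of the inner product. -/
structure MemHatW (T : ℝ) (f : ℝ → ℝ → ℝ) : Prop where
  completelyContinuous : CompletelyContinuous T f
  memLp_top : MemLp (fun q : ℝ × ℝ => dx (dt T f) q.1 q.2) 2 (volume.restrict (Omega T))
  memLp_left : MemLp (fun t => dt T f 0 t) 2 (volume.restrict (Icc 0 T))
  memLp_bottom : MemLp (fun x => dx f x 0) 2 (volume.restrict (Icc 0 1))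

/-- The inner product of `Ŵ(Ω)`. -/
def innerHatW (T : ℝ) (f g : ℝ → ℝ → ℝ) : ℝ :=
  (∫ t in (0 : ℝ)..T, dt T f 0 t * dt T g 0 t)
    + inner1 (fun x => f x 0) (fun x => g x 0)
    + ∫ x in (0 : ℝ)..1, ∫ t in (0 : ℝ)..T, dx (dt T f) x t * dx (dt T g) x t

/-- `Q_y(x)`, which is also `q_s(t)` with `s`, `t` in place of `y`, `x`. -/
def kernelQ (y x : ℝ) : ℝ := if x ≤ y then 1 + x else 1 + y

/-- The reproducing kernel `G_{(y,s)}(x,t) = Q_y(x) q_s(t)` of `Ŵ(Ω)`. -/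
def kernelG (q : ℝ × ℝ) : ℝ → ℝ → ℝ := fun x t => kernelQ q.1 x * kernelQ q.2 t

/-- The operator `L v = ∂²v/∂t² - ∂²v/∂x²`. -/
def waveOp (T : ℝ) (v : ℝ → ℝ → ℝ) : ℝ → ℝ → ℝ := fun x t => D T 0 2 v x t - D T 2 0 v x t

/-- `Ψ = L* φ`, for the adjoint `L*` of `L : W(Ω) → Ŵ(Ω)`. -/
def IsAdjointImage (T : ℝ) (φ Ψ : ℝ → ℝ → ℝ) : Prop :=
  MemW T Ψ ∧ ∀ v, MemW T v → innerW T v Ψ = innerHatW T (waveOp T v) φ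

/-- `v ∈ W(Ω)` solves `L v = M(x, t, v(x,t))` on `Ω`; the homogeneous initial and boundary
conditions are part of `v ∈ W(Ω)`. -/
def IsSolution (T : ℝ) (M : ℝ → ℝ → ℝ → ℝ) (v : ℝ → ℝ → ℝ) : Prop :=
  MemW T v ∧ ∀ x ∈ Icc (0 : ℝ) 1, ∀ t ∈ Icc (0 : ℝ) T, waveOp T v x t = M x t (v x t)

/-- The residual `Ψ_i - ∑_{k<i} ⟨Ψ_i, Ψ̂_k⟩ Ψ̂_k` of the Gram-Schmidt process. -/
def residual (T : ℝ) (Ψ Ψhat : ℕ → ℝ → ℝ → ℝ) (i : ℕ) : ℝ → ℝ → ℝ :=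
  Ψ i - ∑ k ∈ Finset.range i, innerW T (Ψ i) (Ψhat k) • Ψhat k

/-- The objects of the method for the points `p 0, p 1, …` and the right-hand side `M`, each fixed
by its defining equation. Points and coefficients are numbered from `0`, so that `u n` is the sum
of the first `n` terms, `u 0 = 0`, and `u k` is the iterate that enters at the point `p k`. -/
structure Scheme (T : ℝ) (M : ℝ → ℝ → ℝ → ℝ) (p : ℕ → ℝ × ℝ) where
  Ψ : ℕ → ℝ → ℝ → ℝ
  Ψhat : ℕ → ℝ → ℝ → ℝ
  β : ℕ → ℕ → ℝ
  B : ℕ → ℝ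
  u : ℕ → ℝ → ℝ → ℝ
  /-- `Ψ_i = L* φ_i` with `φ_i = G_{p_i}`. -/
  adjoint_eq : ∀ i, IsAdjointImage T (kernelG (p i)) (Ψ i)
  /-- Gram-Schmidt orthonormalization; a vanishing residual gives `Ψ̂_i = 0`. (At the corners
  `(0,0)` and `(1,0)` every `v ∈ W(Ω)` has `L v = 0`, hence `Ψ_i = 0` there.) -/
  gramSchmidt_eq : ∀ i, Ψhat i = (normW T (residual T Ψ Ψhat i))⁻¹ • residual T Ψ Ψhat i
  /-- `Ψ̂_i = ∑_{k≤i} β_{ik} Ψ_k` on `Ω`. -/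
  coeff_eq : ∀ i, ∀ x ∈ Icc (0 : ℝ) 1, ∀ t ∈ Icc (0 : ℝ) T,
    Ψhat i x t = ∑ k ∈ Finset.range (i + 1), β i k * Ψ k x t
  B_eq : ∀ i, B i = ∑ k ∈ Finset.range (i + 1),
    β i k * M (p k).1 (p k).2 (u k (p k).1 (p k).2)
  u_eq : ∀ n, u n = ∑ i ∈ Finset.range n, B i • Ψhat i

end

end SineGordon

/-!
A function `u ∈ W(Ω)` is determined by `F = ∂⁴u/∂x²∂t²`: integrating `F` twice in `t` and inverting
`d²/dx²` under the Dirichlet conditions in `x` recovers `u`. In turn `F` is given by its value at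
the corner, its slopes along two sides and its mixed derivative. These `L²` data form a Hilbert
space, isomorphic to `W(Ω)`, on which the point evaluations of `u` and of `Lu` are continuous, and
`⟪w, Ψ_i⟫ = (Lw)(p_i)` by the reproducing property of `G`.

As the `Ψ̂_i` are orthogonal, boundedness of the iterates makes `∑ B_i Ψ̂_i` converge, to `v` say.
Away from the corners `(0,0)` and `(1,0)`, where `Lw` always vanishes, some `w ∈ W(Ω)` has
`(Lw)(p_i) ≠ 0` and `(Lw)(p_k) = 0` for `k < i`. Hence no other `Ψ_i` lies in the span of its
predecessors, and `(Lv)(p_i) = M(p_i, u_i(p_i))` for every `i`. By density of the points, uniform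
convergence `u_n → v` and continuity of `M`, this gives `Lv = M(·, v)` on `Ω`, so `v` is the
solution.
-/

open scoped InnerProductSpace unitInterval

namespace SineGordon

/-- Lebesgue measure on `[0,l]`. -/
noncomputable abbrev leb (l : ℝ) : Measure ℝ := volume.restrict (Icc 0 l)

theorem continuousOn_primitive_zero {E : Type*} [NormedAddCommGroup E] [NormedSpace ℝ E] {l : ℝ}
    {g : ℝ → E} (hl : 0 ≤ l) (hg : IntegrableOn g (Icc 0 l)) :
    ContinuousOn (fun x => ∫ ξ in (0 : ℝ)..x, g ξ) (Icc 0 l) := by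
  have h := intervalIntegral.continuousOn_primitive_interval (a := 0) (b := l) (μ := volume)
    (f := g) (by rwa [uIcc_of_le hl])
  rwa [uIcc_of_le hl] at h

theorem ae_hasDerivWithinAt_primitive {E : Type*} [NormedAddCommGroup E] [NormedSpace ℝ E]
    [CompleteSpace E] {l : ℝ} (hl : 0 ≤ l) {g : ℝ → E} (hg : IntegrableOn g (Icc 0 l)) :
    ∀ᵐ x ∂leb l,
      HasDerivWithinAt (fun x => ∫ ξ in (0 : ℝ)..x, g ξ) (g x) (Icc 0 l) x := by
  have h := ((intervalIntegrable_iff_integrableOn_Icc_of_le hl).2 hg).ae_hasDerivAt_integral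
  rw [uIcc_of_le hl] at h
  rw [ae_restrict_iff' measurableSet_Icc]
  filter_upwards [h] with x hx hxl
  exact (hx hxl 0 (left_mem_Icc.2 hl)).hasDerivWithinAt

/-! ### Primitives as continuous functions -/

open scoped Classical in
/-- The primitive `x ↦ ∫₀ˣ g` of an integrable function on `[0,1]`, as an element of the Banach
space `C([0,1])`; it is `0` if `g` is not integrable. Applied to the sections of a function on a
rectangle, it turns statements that hold for almost every `t` and all `x` at once into
one-dimensional statements about Bochner integrals. -/
noncomputable def primC (g : ℝ → ℝ) : C(I, ℝ) :=
  if hg : IntegrableOn g I then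
    ⟨fun x => ∫ ξ in (0 : ℝ)..x, g ξ,
      (continuousOn_primitive_zero zero_le_one hg).comp_continuous continuous_subtype_val (·.2)⟩
  else 0

theorem primC_apply {g : ℝ → ℝ} (hg : IntegrableOn g I) (x : I) :
    primC g x = ∫ ξ in (0 : ℝ)..x, g ξ := by
  rw [primC, dif_pos hg, ContinuousMap.coe_mk]

theorem norm_primC_le (g : ℝ → ℝ) : ‖primC g‖ ≤ ∫ ξ in I, ‖g ξ‖ := by
  by_cases hg : IntegrableOn g I
  · refine (ContinuousMap.norm_le _ (integral_nonneg fun _ => norm_nonneg _)).2 fun x => ?_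
    rw [primC_apply hg, intervalIntegral.integral_of_le x.2.1]
    exact (norm_integral_le_integral_norm _).trans (setIntegral_mono_set hg.norm
      (ae_of_all _ fun _ => norm_nonneg _)
      (Ioc_subset_Icc_self.trans (Icc_subset_Icc_right x.2.2)).eventuallyLE)
  · rw [primC, dif_neg hg, norm_zero]
    exact integral_nonneg fun _ => norm_nonneg _

/-- Bernstein approximation recovers a `C([0,1])`-valued function from its values at countably many
points. -/
theorem aestronglyMeasurable_continuousMap {β : Type*} [MeasurableSpace β] {ν : Measure β}
    {F : β → C(I, ℝ)} (hF : ∀ x, AEStronglyMeasurable (fun t => F t x) ν) :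
    AEStronglyMeasurable F ν := by
  refine aestronglyMeasurable_of_tendsto_ae atTop (fun n => ?_)
    (ae_of_all ν fun t => bernsteinApproximation_uniform (F t))
  unfold bernsteinApproximation
  refine Finset.aestronglyMeasurable_fun_sum _ fun k _ => ?_
  have hconst : Continuous fun c : ℝ => ContinuousMap.const I c := ContinuousMap.continuous_const'
  exact (hconst.comp_aestronglyMeasurable (hF _)).const_mul (bernstein n k)

section SectionPrimitives

variable {β : Type*} [MeasurableSpace β] {ν : Measure β} {k : β → ℝ → ℝ}

theorem integrable_primC [SFinite ν]
    (hk : Integrable (Function.uncurry k) (ν.prod (leb 1))) :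
    Integrable (fun t => primC (k t)) ν := by
  refine (hk.norm.integral_prod_left).mono' (aestronglyMeasurable_continuousMap fun x => ?_)
    (ae_of_all ν fun t => norm_primC_le (k t))
  have hx : Ioc (0 : ℝ) x ⊆ I := Ioc_subset_Icc_self.trans (Icc_subset_Icc_right x.2.2)
  have hm : AEStronglyMeasurable (Function.uncurry k) (ν.prod (volume.restrict (Ioc 0 (x : ℝ)))) :=
    hk.aestronglyMeasurable.mono_measure
      (Measure.prod_mono le_rfl (Measure.restrict_mono hx le_rfl))
  refine hm.integral_prod_right'.congr ?_
  filter_upwards [hk.prod_right_ae] with t ht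
  exact ((primC_apply ht x).trans (intervalIntegral.integral_of_le x.2.1)).symm

theorem ae_prod_hasDerivAt_of_ae_ae {F : β → C(I, ℝ)} (hF : AEStronglyMeasurable F ν)
    (hk : AEStronglyMeasurable (Function.uncurry k) (ν.prod (leb 1)))
    (h : ∀ᵐ t ∂ν, ∀ᵐ x ∂leb 1, HasDerivAt (IccExtend zero_le_one (F t)) (k t x) x) :
    ∀ᵐ q ∂(ν.prod (leb 1)),
      HasDerivAt (IccExtend zero_le_one (F q.1)) (k q.1 q.2) q.2 := by
  borelize C(I, ℝ)
  obtain ⟨F', hF', hFF'⟩ := hF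
  obtain ⟨k', hk', hkk'⟩ := hk
  have hcont : Continuous (Function.uncurry fun (φ : C(I, ℝ)) (x : ℝ) =>
      IccExtend (zero_le_one (α := ℝ)) φ x) :=
    continuous_eval.comp (continuous_fst.prodMk
      ((continuous_projIcc (h := zero_le_one)).comp continuous_snd))
  have hpair : Measurable fun q : β × ℝ => (F' q.1, q.2) :=
    (hF'.measurable.comp measurable_fst).prodMk measurable_snd
  have hmeas : MeasurableSet {q : β × ℝ | DifferentiableAt ℝ (IccExtend zero_le_one (F' q.1)) q.2 ∧
      deriv (IccExtend zero_le_one (F' q.1)) q.2 = k' q} :=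
    (hpair (measurableSet_of_differentiableAt_with_param ℝ hcont)).inter
      (measurableSet_eq_fun ((measurable_deriv_with_param hcont).comp hpair) hk'.measurable)
  have hderiv := (Measure.ae_prod_iff_ae_ae hmeas).2 (by
    filter_upwards [h, hFF', Measure.ae_ae_of_ae_prod hkk'] with t ht hFt hkt
    filter_upwards [ht, hkt] with x hx hkx
    rw [hFt] at hx
    exact ⟨hx.differentiableAt, hx.deriv.trans hkx⟩)
  filter_upwards [hderiv, hkk', Measure.quasiMeasurePreserving_fst.ae hFF'] with q hq hkq hFq
  rw [hFq, show k q.1 q.2 = _ from hkq, ← hq.2]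
  exact hq.1.hasDerivAt

theorem ae_prod_hasDerivWithinAt_primitive [SFinite ν]
    (hk : Integrable (Function.uncurry k) (ν.prod (leb 1))) :
    ∀ᵐ q ∂(ν.prod (leb 1)),
      HasDerivWithinAt (fun x => ∫ ξ in (0 : ℝ)..x, k q.1 ξ) (k q.1 q.2) I q.2 := by
  have hIoo : ∀ᵐ x ∂leb 1, x ∈ Ioo (0 : ℝ) 1 := by
    rw [leb, ← restrict_Ioo_eq_restrict_Icc]
    exact ae_restrict_mem measurableSet_Ioo
  have heq : ∀ t, IntegrableOn (k t) I → ∀ x ∈ I,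
      IccExtend zero_le_one (primC (k t)) x = ∫ ξ in (0 : ℝ)..x, k t ξ := fun t ht x hx => by
    rw [IccExtend_of_mem zero_le_one _ hx, primC_apply ht]
  have hae := ae_prod_hasDerivAt_of_ae_ae (integrable_primC hk).aestronglyMeasurable
    hk.aestronglyMeasurable (by
      filter_upwards [hk.prod_right_ae] with t ht
      filter_upwards [ae_hasDerivWithinAt_primitive zero_le_one ht, hIoo] with x hx hxI
      exact (hx.congr (heq t ht) (heq t ht x (Ioo_subset_Icc_self hxI))).hasDerivAt
        (Icc_mem_nhds hxI.1 hxI.2))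
  filter_upwards [hae, Measure.quasiMeasurePreserving_fst.ae hk.prod_right_ae,
    Measure.quasiMeasurePreserving_snd.ae hIoo] with q hq hint hqI
  exact hq.hasDerivWithinAt.congr (fun x hx => (heq q.1 hint x hx).symm)
    (heq q.1 hint q.2 (Ioo_subset_Icc_self hqI)).symm

end SectionPrimitives

/-! ### Complete continuity -/

/-- The primitive in `x`. -/
noncomputable def primX (f : ℝ → ℝ → ℝ) : ℝ → ℝ → ℝ := fun x t => ∫ ξ in (0 : ℝ)..x, f ξ t

/-- The primitive in `t`. -/
noncomputable def primT (f : ℝ → ℝ → ℝ) : ℝ → ℝ → ℝ := fun x t => ∫ τ in (0 : ℝ)..t, f x τ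

theorem restrict_Omega (T : ℝ) : (volume : Measure (ℝ × ℝ)).restrict (Omega T) =
    (leb 1).prod (leb T) := by
  rw [Omega, Measure.volume_eq_prod, Measure.prod_restrict]

theorem uIoc_prod_subset_Omega {T x t : ℝ} (hx : x ∈ Icc (0 : ℝ) 1) (ht : t ∈ Icc (0 : ℝ) T) :
    uIoc 0 x ×ˢ uIoc 0 t ⊆ Omega T := by
  rw [uIoc_of_le hx.1, uIoc_of_le ht.1]
  exact prod_mono (Ioc_subset_Icc_self.trans (Icc_subset_Icc_right hx.2))
    (Ioc_subset_Icc_self.trans (Icc_subset_Icc_right ht.2))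

theorem primX_primT_comm {T : ℝ} {h : ℝ → ℝ → ℝ}
    (hh : IntegrableOn (fun q : ℝ × ℝ => h q.1 q.2) (Omega T)) {x t : ℝ}
    (hx : x ∈ Icc (0 : ℝ) 1) (ht : t ∈ Icc (0 : ℝ) T) :
    primX (primT h) x t = primT (primX h) x t :=
  intervalIntegral_intervalIntegral_swap (hh.mono_set (uIoc_prod_subset_Omega hx ht))

/-- `f(x,t) = f(0,0) + ∫₀ˣ a + ∫₀ᵗ b + ∫₀ˣ∫₀ᵗ h` on the rectangle, the representation in the
definition of complete continuity with the data made explicit. -/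
def IsDoublePrimitive (T : ℝ) (f : ℝ → ℝ → ℝ) (a b : ℝ → ℝ) (h : ℝ → ℝ → ℝ) : Prop :=
  ∀ x ∈ Icc (0 : ℝ) 1, ∀ t ∈ Icc (0 : ℝ) T,
    f x t = f 0 0 + (∫ ξ in (0 : ℝ)..x, a ξ) + (∫ τ in (0 : ℝ)..t, b τ)
      + ∫ ξ in (0 : ℝ)..x, ∫ τ in (0 : ℝ)..t, h ξ τ

section DoublePrimitive

variable {T : ℝ} {f : ℝ → ℝ → ℝ} {a b : ℝ → ℝ} {h : ℝ → ℝ → ℝ}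

theorem integrable_swap (hh : IntegrableOn (fun q : ℝ × ℝ => h q.1 q.2) (Omega T)) :
    Integrable (Function.uncurry fun t x => h x t)
      ((leb T).prod (leb 1)) := by
  rw [IntegrableOn, restrict_Omega] at hh
  exact hh.swap

theorem primC_integral_apply (hh : IntegrableOn (fun q : ℝ × ℝ => h q.1 q.2) (Omega T))
    {x t : ℝ} (hx : x ∈ I) (ht : t ∈ Icc 0 T) :
    (∫ τ in (0 : ℝ)..t, primC fun ξ => h ξ τ) ⟨x, hx⟩ = primX (primT h) x t := by
  have hsub : Ioc 0 t ⊆ Icc 0 T := Ioc_subset_Icc_self.trans (Icc_subset_Icc_right ht.2)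
  have hint : IntervalIntegrable (fun τ => primC fun ξ => h ξ τ) volume 0 t :=
    (intervalIntegrable_iff_integrableOn_Ioc_of_le ht.1).2
      ((integrable_primC (integrable_swap hh)).mono_measure (Measure.restrict_mono hsub le_rfl))
  rw [primX_primT_comm hh hx ht]
  refine ((ContinuousMap.evalCLM ℝ (⟨x, hx⟩ : I)).intervalIntegral_comp_comm hint).symm.trans
    (intervalIntegral.integral_congr_ae_restrict ?_)
  rw [uIoc_of_le ht.1]
  filter_upwards [ae_restrict_of_ae_restrict_of_subset hsub (integrable_swap hh).prod_right_ae]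
    with τ hτ
  exact primC_apply hτ ⟨x, hx⟩

namespace IsDoublePrimitive

theorem apply_bottom (hf : IsDoublePrimitive T f a b h) (hT : 0 ≤ T) {x : ℝ}
    (hx : x ∈ Icc (0 : ℝ) 1) : f x 0 = f 0 0 + ∫ ξ in (0 : ℝ)..x, a ξ := by
  simpa using hf x hx 0 (left_mem_Icc.2 hT)

theorem apply_left (hf : IsDoublePrimitive T f a b h) {t : ℝ}
    (ht : t ∈ Icc (0 : ℝ) T) : f 0 t = f 0 0 + ∫ τ in (0 : ℝ)..t, b τ := by
  simpa using hf 0 (left_mem_Icc.2 zero_le_one) t ht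

theorem ae_dx_bottom (hf : IsDoublePrimitive T f a b h) (hT : 0 ≤ T)
    (ha : IntegrableOn a (Icc 0 1)) :
    ∀ᵐ x ∂leb 1, dx f x 0 = a x := by
  filter_upwards [ae_hasDerivWithinAt_primitive zero_le_one ha,
    ae_restrict_mem measurableSet_Icc] with x hx hxm
  exact ((hx.const_add (f 0 0)).congr_of_mem (fun y hy => hf.apply_bottom hT hy) hxm).derivWithin
    (uniqueDiffOn_Icc one_pos x hxm)

theorem ae_dt_left (hf : IsDoublePrimitive T f a b h) (hT : 0 < T)
    (hb : IntegrableOn b (Icc 0 T)) :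
    ∀ᵐ t ∂leb T, dt T f 0 t = b t := by
  filter_upwards [ae_hasDerivWithinAt_primitive hT.le hb,
    ae_restrict_mem measurableSet_Icc] with t ht htm
  exact ((ht.const_add (f 0 0)).congr_of_mem (fun s hs => hf.apply_left hs) htm).derivWithin
    (uniqueDiffOn_Icc hT t htm)

theorem ae_dt (hf : IsDoublePrimitive T f a b h) (hT : 0 < T) (hb : IntegrableOn b (Icc 0 T))
    (hh : IntegrableOn (fun q : ℝ × ℝ => h q.1 q.2) (Omega T)) :
    ∀ᵐ t ∂leb T, ∀ x ∈ Icc (0 : ℝ) 1,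
      dt T f x t = b t + primX h x t := by
  filter_upwards [ae_hasDerivWithinAt_primitive hT.le hb, ae_restrict_mem measurableSet_Icc,
    ae_hasDerivWithinAt_primitive hT.le (integrable_primC (integrable_swap hh)),
    (integrable_swap hh).prod_right_ae] with t hbt ht hht hint x hx
  have heval := (ContinuousMap.evalCLM ℝ (⟨x, hx⟩ : I)).hasFDerivAt.comp_hasDerivWithinAt t hht
  have hval : b t + primX h x t = b t + primC (fun ξ => h ξ t) ⟨x, hx⟩ :=
    congrArg (b t + ·) (primC_apply hint ⟨x, hx⟩).symm
  rw [hval]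
  refine (((hbt.add heval).const_add (f 0 0 + ∫ ξ in (0 : ℝ)..x, a ξ)).congr_of_mem
    (fun s hs => ?_) ht).derivWithin (uniqueDiffOn_Icc hT t ht)
  rw [hf x hx s hs, add_assoc _ (∫ τ in (0 : ℝ)..s, b τ)]
  exact congrArg (fun c => _ + (_ + c)) (primC_integral_apply hh hx hs).symm

theorem ae_dx_dt (hf : IsDoublePrimitive T f a b h) (hT : 0 < T) (hb : IntegrableOn b (Icc 0 T))
    (hh : IntegrableOn (fun q : ℝ × ℝ => h q.1 q.2) (Omega T)) :
    ∀ᵐ q ∂((leb 1).prod (leb T)), dx (dt T f) q.1 q.2 = h q.1 q.2 := by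
  filter_upwards [Measure.quasiMeasurePreserving_snd.ae (hf.ae_dt hT hb hh),
    Measure.quasiMeasurePreserving_fst.ae (ae_restrict_mem measurableSet_Icc),
    Measure.measurePreserving_swap.quasiMeasurePreserving.ae
      (ae_prod_hasDerivWithinAt_primitive (integrable_swap hh))] with q hdt hq hderiv
  exact ((hderiv.const_add (b q.2)).congr_of_mem (fun x hx => hdt x hx) hq).derivWithin
    (uniqueDiffOn_Icc one_pos _ hq)

theorem continuousOn (hf : IsDoublePrimitive T f a b h) (hT : 0 ≤ T)
    (ha : IntegrableOn a (Icc 0 1)) (hb : IntegrableOn b (Icc 0 T))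
    (hh : IntegrableOn (fun q : ℝ × ℝ => h q.1 q.2) (Omega T)) :
    ContinuousOn (fun q : ℝ × ℝ => f q.1 q.2) (Omega T) := by
  have hcurve := continuousOn_primitive_zero hT (integrable_primC (integrable_swap hh))
  have hh' : ContinuousOn (fun q : ℝ × ℝ => (∫ τ in (0 : ℝ)..q.2, primC fun ξ => h ξ τ)
      (projIcc 0 1 zero_le_one q.1)) (Omega T) :=
    continuous_eval.comp_continuousOn ((hcurve.comp continuousOn_snd fun q hq => hq.2).prodMk
      ((continuous_projIcc (h := zero_le_one)).comp continuous_fst).continuousOn)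
  have ha' := (continuousOn_primitive_zero zero_le_one ha).comp (t := Icc 0 1) (s := Omega T)
    continuousOn_fst fun q hq => hq.1
  have hb' := (continuousOn_primitive_zero hT hb).comp (t := Icc 0 T) (s := Omega T)
    continuousOn_snd fun q hq => hq.2
  refine ((((continuousOn_const (c := f 0 0)).add ha').add hb').add hh').congr fun q hq => ?_
  simp only [Pi.add_apply, Function.comp_apply, projIcc_of_mem zero_le_one hq.1,
    primC_integral_apply hh hq.1 hq.2]
  exact hf _ hq.1 _ hq.2

end IsDoublePrimitive

end DoublePrimitive

/-! ### Square integrable functions on products -/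

section SquareIntegrable

variable {α β : Type*} [MeasurableSpace α] [MeasurableSpace β] {μ : Measure α} {ν : Measure β}

theorem inner_Lp_eq (f g : Lp ℝ 2 μ) : ⟪f, g⟫_ℝ = ∫ x, f x * g x ∂μ := by
  simp only [L2.inner_def, Real.inner_apply]

theorem norm_sq_Lp_eq (f : Lp ℝ 2 μ) : ‖f‖ ^ 2 = ∫ x, f x ^ 2 ∂μ := by
  rw [← real_inner_self_eq_norm_sq, inner_Lp_eq]
  simp only [sq]

theorem sq_integral_mul_le {w g : α → ℝ} (hw : MemLp w 2 μ) (hg : MemLp g 2 μ) :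
    (∫ x, w x * g x ∂μ) ^ 2 ≤ (∫ x, w x ^ 2 ∂μ) * ∫ x, g x ^ 2 ∂μ := by
  have hinner : ⟪hw.toLp w, hg.toLp g⟫_ℝ = ∫ x, w x * g x ∂μ := by
    rw [inner_Lp_eq]
    exact integral_congr_ae (hw.coeFn_toLp.mul hg.coeFn_toLp)
  have hnorm : ∀ {v : α → ℝ} (hv : MemLp v 2 μ), ‖hv.toLp v‖ ^ 2 = ∫ x, v x ^ 2 ∂μ := fun hv => by
    rw [norm_sq_Lp_eq]
    exact integral_congr_ae (hv.coeFn_toLp.pow_const 2)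
  rw [← hinner, ← hnorm hw, ← hnorm hg, ← mul_pow, ← sq_abs]
  gcongr
  exact abs_real_inner_le_norm _ _

variable [SFinite μ] [SFinite ν] {w : α → ℝ} {k : α × β → ℝ}

theorem ae_memLp_section (hk : MemLp k 2 (μ.prod ν)) : ∀ᵐ t ∂ν, MemLp (fun x => k (x, t)) 2 μ := by
  filter_upwards [hk.aestronglyMeasurable.prodMk_right, hk.integrable_sq.prod_left_ae] with t hm ht
  exact (memLp_two_iff_integrable_sq hm).2 ht

theorem ae_sq_integral_mul_le (hw : MemLp w 2 μ) (hk : MemLp k 2 (μ.prod ν)) :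
    ∀ᵐ t ∂ν, (∫ x, w x * k (x, t) ∂μ) ^ 2 ≤ (∫ x, w x ^ 2 ∂μ) * ∫ x, k (x, t) ^ 2 ∂μ :=
  (ae_memLp_section hk).mono fun _ ht => sq_integral_mul_le hw ht

theorem memLp_integral_mul (hw : MemLp w 2 μ) (hk : MemLp k 2 (μ.prod ν)) :
    MemLp (fun t => ∫ x, w x * k (x, t) ∂μ) 2 ν := by
  have hm : AEStronglyMeasurable (fun t => ∫ x, w x * k (x, t) ∂μ) ν :=
    (hw.aestronglyMeasurable.comp_fst.mul hk.aestronglyMeasurable).prod_swap.integral_prod_right'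
  refine (memLp_two_iff_integrable_sq hm).2
    ((hk.integrable_sq.integral_prod_right.const_mul (∫ x, w x ^ 2 ∂μ)).mono' (hm.pow 2) ?_)
  filter_upwards [ae_sq_integral_mul_le hw hk] with t ht
  rwa [Real.norm_of_nonneg (sq_nonneg _)]

theorem integral_sq_integral_mul_le (hw : MemLp w 2 μ) (hk : MemLp k 2 (μ.prod ν)) :
    ∫ t, (∫ x, w x * k (x, t) ∂μ) ^ 2 ∂ν ≤ (∫ x, w x ^ 2 ∂μ) * ∫ q, k q ^ 2 ∂(μ.prod ν) := by
  rw [integral_prod_symm _ hk.integrable_sq, ← integral_const_mul]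
  exact integral_mono_ae (memLp_integral_mul hw hk).integrable_sq
    (hk.integrable_sq.integral_prod_right.const_mul _) (ae_sq_integral_mul_le hw hk)

theorem ae_ae_section {P : α × β → Prop} (h : ∀ᵐ q ∂(μ.prod ν), P q) :
    ∀ᵐ t ∂ν, ∀ᵐ x ∂μ, P (x, t) :=
  Measure.ae_ae_of_ae_prod (Measure.measurePreserving_swap.quasiMeasurePreserving.ae h)

/-- The bounded operator `k ↦ ∫ w(x) k(x, ·) dμ(x)` between `L²` spaces. -/
noncomputable def partialIntegral (hw : MemLp w 2 μ) : Lp ℝ 2 (μ.prod ν) →L[ℝ] Lp ℝ 2 ν :=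
  LinearMap.mkContinuous
    { toFun := fun k => (memLp_integral_mul hw (Lp.memLp k)).toLp _
      map_add' := fun k k' => by
        rw [← MemLp.toLp_add]
        refine (MemLp.toLp_eq_toLp_iff _ _).2 ?_
        filter_upwards [ae_ae_section (Lp.coeFn_add k k'), ae_memLp_section (Lp.memLp k),
          ae_memLp_section (Lp.memLp k')] with t ht hk hk'
        rw [Pi.add_apply]
        refine (integral_congr_ae (ht.mono fun x hx => ?_)).trans
          (integral_add (hw.integrable_mul hk) (hw.integrable_mul hk'))
        simp only [hx, Pi.add_apply, mul_add]
      map_smul' := fun c k => by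
        rw [RingHom.id_apply, ← MemLp.toLp_const_smul]
        refine (MemLp.toLp_eq_toLp_iff _ _).2 ?_
        filter_upwards [ae_ae_section (Lp.coeFn_smul c k)] with t ht
        rw [Pi.smul_apply, smul_eq_mul, ← integral_const_mul]
        refine integral_congr_ae (ht.mono fun x hx => ?_)
        simp only [hx, Pi.smul_apply, smul_eq_mul, mul_left_comm] }
    (√(∫ x, w x ^ 2 ∂μ)) fun k => by
      refine le_of_sq_le_sq ?_ (by positivity)
      rw [mul_pow, Real.sq_sqrt (integral_nonneg fun x => sq_nonneg _), norm_sq_Lp_eq,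
        norm_sq_Lp_eq]
      exact (integral_congr_ae
        ((memLp_integral_mul hw (Lp.memLp k)).coeFn_toLp.pow_const 2)).trans_le
          (integral_sq_integral_mul_le hw (Lp.memLp k))

theorem coeFn_partialIntegral (hw : MemLp w 2 μ) (k : Lp ℝ 2 (μ.prod ν)) :
    ∀ᵐ t ∂ν, partialIntegral hw k t = ∫ x, w x * k (x, t) ∂μ :=
  (memLp_integral_mul hw (Lp.memLp k)).coeFn_toLp

end SquareIntegrable

theorem intervalIntegral_eq_integral_leb {E : Type*} [NormedAddCommGroup E] [NormedSpace ℝ E]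
    {l : ℝ} (hl : 0 ≤ l) (g : ℝ → E) : ∫ x in (0 : ℝ)..l, g x = ∫ x, g x ∂leb l := by
  rw [intervalIntegral.integral_of_le hl, integral_Icc_eq_integral_Ioc]

section PrimitiveMemLp

variable {β : Type*} [MeasurableSpace β] {ν : Measure β} [SFinite ν] {l : ℝ} {k : ℝ × β → ℝ}

theorem aestronglyMeasurable_primitive (hk : AEStronglyMeasurable k ((leb l).prod ν)) :
    AEStronglyMeasurable (fun q : ℝ × β => ∫ ξ in (0 : ℝ)..q.1, k (ξ, q.2)) ((leb l).prod ν) := by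
  have hproj : Measure.QuasiMeasurePreserving (fun z : (ℝ × β) × ℝ => (z.2, z.1.2))
      (((leb l).prod ν).prod (leb l)) ((leb l).prod ν) :=
    Measure.measurePreserving_swap.quasiMeasurePreserving.comp
      (QuasiMeasurePreserving.prodMap Measure.quasiMeasurePreserving_snd
        (Measure.QuasiMeasurePreserving.id (leb l)))
  have hset : MeasurableSet {z : (ℝ × β) × ℝ | z.2 ∈ Ioc 0 z.1.1} :=
    (measurableSet_lt measurable_const measurable_snd).inter
      (measurableSet_le measurable_snd (by fun_prop))
  refine ((hk.comp_quasiMeasurePreserving hproj).indicator hset).integral_prod_right'.congr ?_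
  filter_upwards [Measure.quasiMeasurePreserving_fst.ae (ae_restrict_mem measurableSet_Icc)]
    with q hq
  have hsub : Ioc 0 q.1 ⊆ Icc 0 l := Ioc_subset_Icc_self.trans (Icc_subset_Icc_right hq.2)
  change ∫ ξ, (Ioc 0 q.1).indicator (fun ξ => k (ξ, q.2)) ξ ∂leb l = _
  rw [intervalIntegral.integral_of_le hq.1, integral_indicator measurableSet_Ioc,
    Measure.restrict_restrict measurableSet_Ioc, inter_eq_left.2 hsub]

theorem memLp_primitive (hk : MemLp k 2 ((leb l).prod ν)) :
    MemLp (fun q : ℝ × β => ∫ ξ in (0 : ℝ)..q.1, k (ξ, q.2)) 2 ((leb l).prod ν) := by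
  have hbound := (memLp_integral_mul (memLp_const (1 : ℝ)) hk.norm).comp_snd (leb l)
  refine hbound.mono' (aestronglyMeasurable_primitive hk.aestronglyMeasurable) ?_
  filter_upwards [Measure.quasiMeasurePreserving_fst.ae (ae_restrict_mem measurableSet_Icc),
    Measure.quasiMeasurePreserving_snd.ae (ae_memLp_section hk)] with q hq hsec
  simp only [one_mul]
  rw [intervalIntegral.integral_of_le hq.1]
  exact (norm_integral_le_integral_norm _).trans (setIntegral_mono_set
    (hsec.integrable one_le_two).norm (ae_of_all _ fun _ => norm_nonneg _)
    (Ioc_subset_Icc_self.trans (Icc_subset_Icc_right hq.2)).eventuallyLE)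

end PrimitiveMemLp

theorem memLp_primX {T : ℝ} {k : ℝ → ℝ → ℝ}
    (hk : MemLp (fun q : ℝ × ℝ => k q.1 q.2) 2 ((leb 1).prod (leb T))) :
    MemLp (fun q : ℝ × ℝ => primX k q.1 q.2) 2 ((leb 1).prod (leb T)) :=
  memLp_primitive hk

theorem memLp_primT {T : ℝ} {k : ℝ → ℝ → ℝ}
    (hk : MemLp (fun q : ℝ × ℝ => k q.1 q.2) 2 ((leb 1).prod (leb T))) :
    MemLp (fun q : ℝ × ℝ => primT k q.1 q.2) 2 ((leb 1).prod (leb T)) :=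
  have hk' := hk.comp_measurePreserving Measure.measurePreserving_swap
  (memLp_primitive hk').comp_measurePreserving Measure.measurePreserving_swap

theorem integrableOn_Omega_of_memLp {T : ℝ} {k : ℝ → ℝ → ℝ}
    (hk : MemLp (fun q : ℝ × ℝ => k q.1 q.2) 2 ((leb 1).prod (leb T))) :
    IntegrableOn (fun q : ℝ × ℝ => k q.1 q.2) (Omega T) := by
  rw [IntegrableOn, restrict_Omega]
  exact hk.integrable one_le_two

/-- `f` is a double primitive with square integrable data. -/
structure IsL2Primitive (T : ℝ) (f : ℝ → ℝ → ℝ) (a b : ℝ → ℝ) (h : ℝ → ℝ → ℝ) : Prop where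
  a_memLp : MemLp a 2 (leb 1)
  b_memLp : MemLp b 2 (leb T)
  h_memLp : MemLp (fun q : ℝ × ℝ => h q.1 q.2) 2 ((leb 1).prod (leb T))
  prim : IsDoublePrimitive T f a b h

namespace IsL2Primitive

variable {T : ℝ} {f : ℝ → ℝ → ℝ} {a b : ℝ → ℝ} {h : ℝ → ℝ → ℝ}

theorem a_int (hf : IsL2Primitive T f a b h) : IntegrableOn a (Icc 0 1) :=
  hf.a_memLp.integrable one_le_two

theorem b_int (hf : IsL2Primitive T f a b h) : IntegrableOn b (Icc 0 T) :=
  hf.b_memLp.integrable one_le_two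

theorem h_int (hf : IsL2Primitive T f a b h) :
    IntegrableOn (fun q : ℝ × ℝ => h q.1 q.2) (Omega T) :=
  integrableOn_Omega_of_memLp hf.h_memLp

theorem ae_dx_bottom (hf : IsL2Primitive T f a b h) (hT : 0 ≤ T) :
    ∀ᵐ x ∂leb 1, dx f x 0 = a x :=
  hf.prim.ae_dx_bottom hT hf.a_int

theorem ae_dt_left (hf : IsL2Primitive T f a b h) (hT : 0 < T) : ∀ᵐ t ∂leb T, dt T f 0 t = b t :=
  hf.prim.ae_dt_left hT hf.b_int

theorem ae_dx_dt (hf : IsL2Primitive T f a b h) (hT : 0 < T) :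
    ∀ᵐ q ∂((leb 1).prod (leb T)), dx (dt T f) q.1 q.2 = h q.1 q.2 :=
  hf.prim.ae_dx_dt hT hf.b_int hf.h_int

theorem memHatW (hf : IsL2Primitive T f a b h) (hT : 0 < T) : MemHatW T f where
  completelyContinuous := ⟨a, b, h, hf.a_int, hf.b_int, hf.h_int, hf.prim⟩
  memLp_top := by
    rw [restrict_Omega]
    exact (memLp_congr_ae (hf.ae_dx_dt hT)).2 hf.h_memLp
  memLp_left := (memLp_congr_ae (hf.ae_dt_left hT)).2 hf.b_memLp
  memLp_bottom := (memLp_congr_ae (hf.ae_dx_bottom hT.le)).2 hf.a_memLp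

theorem continuousOn (hf : IsL2Primitive T f a b h) (hT : 0 ≤ T) :
    ContinuousOn (fun q : ℝ × ℝ => f q.1 q.2) (Omega T) :=
  hf.prim.continuousOn hT hf.a_int hf.b_int hf.h_int

end IsL2Primitive

theorem MemHatW.exists_isL2Primitive {T : ℝ} (hT : 0 < T) {f : ℝ → ℝ → ℝ} (hf : MemHatW T f) :
    ∃ a b h, IsL2Primitive T f a b h := by
  obtain ⟨a, b, h, ha, hb, hh, hp : IsDoublePrimitive T f a b h⟩ := hf.completelyContinuous
  have htop := hf.memLp_top
  rw [restrict_Omega] at htop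
  exact ⟨a, b, h, (memLp_congr_ae (hp.ae_dx_bottom hT.le ha)).1 hf.memLp_bottom,
    (memLp_congr_ae (hp.ae_dt_left hT hb)).1 hf.memLp_left,
    (memLp_congr_ae (hp.ae_dx_dt hT hb hh)).1 htop, hp⟩

theorem intervalIntegral_mul_eq_of_ae {l : ℝ} (hl : 0 ≤ l) {f g f' g' : ℝ → ℝ}
    (hf : ∀ᵐ x ∂leb l, f x = f' x) (hg : ∀ᵐ x ∂leb l, g x = g' x) :
    ∫ x in (0 : ℝ)..l, f x * g x = ∫ x, f' x * g' x ∂leb l := by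
  rw [intervalIntegral_eq_integral_leb hl]
  exact integral_congr_ae (EventuallyEq.mul hf hg)

theorem iteratedIntegral_mul_eq_of_ae {T : ℝ} (hT : 0 ≤ T) {f g f' g' : ℝ → ℝ → ℝ}
    (hf : ∀ᵐ q ∂((leb 1).prod (leb T)), f q.1 q.2 = f' q.1 q.2)
    (hg : ∀ᵐ q ∂((leb 1).prod (leb T)), g q.1 q.2 = g' q.1 q.2)
    (hf' : MemLp (fun q : ℝ × ℝ => f' q.1 q.2) 2 ((leb 1).prod (leb T)))
    (hg' : MemLp (fun q : ℝ × ℝ => g' q.1 q.2) 2 ((leb 1).prod (leb T))) :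
    ∫ x in (0 : ℝ)..1, ∫ t in (0 : ℝ)..T, f x t * g x t =
      ∫ q, f' q.1 q.2 * g' q.1 q.2 ∂((leb 1).prod (leb T)) := by
  have heq : (fun q : ℝ × ℝ => f q.1 q.2 * g q.1 q.2) =ᵐ[(leb 1).prod (leb T)]
      fun q => f' q.1 q.2 * g' q.1 q.2 := EventuallyEq.mul hf hg
  rw [intervalIntegral_eq_integral_leb zero_le_one, ← integral_congr_ae heq,
    integral_prod _ ((hf'.integrable_mul hg').congr heq.symm)]
  exact integral_congr_ae (ae_of_all _ fun x => intervalIntegral_eq_integral_leb hT _)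

/-! ### The reproducing kernel -/

theorem innerHatW_eq {T : ℝ} (hT : 0 < T) {f g : ℝ → ℝ → ℝ} {a b a' b' : ℝ → ℝ}
    {h h' : ℝ → ℝ → ℝ} (hf : IsL2Primitive T f a b h) (hg : IsL2Primitive T g a' b' h') :
    innerHatW T f g = (∫ t, b t * b' t ∂leb T) + (f 0 0 * g 0 0 + ∫ x, a x * a' x ∂leb 1)
      + ∫ q, h q.1 q.2 * h' q.1 q.2 ∂((leb 1).prod (leb T)) := by
  unfold innerHatW inner1
  rw [intervalIntegral_mul_eq_of_ae hT.le (hf.ae_dt_left hT) (hg.ae_dt_left hT),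
    iteratedIntegral_mul_eq_of_ae hT.le (hf.ae_dx_dt hT) (hg.ae_dx_dt hT) hf.h_memLp hg.h_memLp,
    ← intervalIntegral_mul_eq_of_ae zero_le_one (hf.ae_dx_bottom hT.le) (hg.ae_dx_bottom hT.le)]
  rfl

theorem integral_mul_indicator_Ioc {l y : ℝ} (hy : y ∈ Icc 0 l) (c : ℝ → ℝ) :
    ∫ x, c x * (Ioc 0 y).indicator 1 x ∂leb l = ∫ x in (0 : ℝ)..y, c x := by
  simp only [← indicator_mul_right, Pi.one_apply, mul_one]
  rw [integral_indicator measurableSet_Ioc, Measure.restrict_restrict measurableSet_Ioc,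
    inter_eq_left.2 (Ioc_subset_Icc_self.trans (Icc_subset_Icc_right hy.2)),
    intervalIntegral.integral_of_le hy.1]

theorem kernelQ_eq {y x : ℝ} (hy : 0 ≤ y) (hx : 0 ≤ x) :
    kernelQ y x = 1 + ∫ ξ in (0 : ℝ)..x, (Ioc 0 y).indicator 1 ξ := by
  rw [intervalIntegral.integral_of_le hx, setIntegral_indicator measurableSet_Ioc, Ioc_inter_Ioc,
    kernelQ]
  split_ifs with h
  · simp [h, hx]
  · simp [(not_le.1 h).le, hy]

theorem isL2Primitive_kernelG {T : ℝ} {q : ℝ × ℝ} (hq : q ∈ Omega T) :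
    IsL2Primitive T (kernelG q) ((Ioc 0 q.1).indicator 1) ((Ioc 0 q.2).indicator 1)
      (fun x t => (Ioc 0 q.1).indicator 1 x * (Ioc 0 q.2).indicator 1 t) where
  a_memLp := (memLp_const (1 : ℝ)).indicator measurableSet_Ioc
  b_memLp := (memLp_const (1 : ℝ)).indicator measurableSet_Ioc
  h_memLp := by
    simp only [← indicator_prod_one]
    exact (memLp_const (1 : ℝ)).indicator (measurableSet_Ioc.prod measurableSet_Ioc)
  prim := fun x hx t ht => by
    simp only [kernelG, intervalIntegral.integral_const_mul, intervalIntegral.integral_mul_const]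
    rw [kernelQ_eq hq.1.1 hx.1, kernelQ_eq hq.2.1 ht.1, kernelQ_eq hq.1.1 le_rfl,
      kernelQ_eq hq.2.1 le_rfl, intervalIntegral.integral_same, intervalIntegral.integral_same]
    ring

theorem innerHatW_kernelG {T : ℝ} (hT : 0 < T) {f : ℝ → ℝ → ℝ} (hf : MemHatW T f) {q : ℝ × ℝ}
    (hq : q ∈ Omega T) : innerHatW T f (kernelG q) = f q.1 q.2 := by
  obtain ⟨a, b, h, hf⟩ := hf.exists_isL2Primitive hT
  have hG := isL2Primitive_kernelG hq
  have htop : ∫ z, h z.1 z.2 * ((Ioc 0 q.1).indicator 1 z.1 * (Ioc 0 q.2).indicator 1 z.2)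
      ∂((leb 1).prod (leb T)) = ∫ x in (0 : ℝ)..q.1, ∫ t in (0 : ℝ)..q.2, h x t := by
    rw [← integral_mul_indicator_Ioc hq.1]
    refine (integral_prod _ (hf.h_memLp.integrable_mul hG.h_memLp)).trans
      (integral_congr_ae (ae_of_all _ fun x => ?_))
    simp only [← integral_mul_indicator_Ioc hq.2, ← integral_mul_const]
    exact integral_congr_ae (ae_of_all _ fun t => by simp only [Pi.mul_apply]; ring)
  rw [innerHatW_eq hT hf hG, htop, integral_mul_indicator_Ioc hq.1, integral_mul_indicator_Ioc hq.2,
    hf.prim _ hq.1 _ hq.2, kernelG, kernelQ_eq hq.1.1 le_rfl, kernelQ_eq hq.2.1 le_rfl,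
    intervalIntegral.integral_same, intervalIntegral.integral_same]
  ring

/-! ### Integral operators on continuous functions -/

theorem continuous_curry_left (g : C(ℝ × ℝ, ℝ)) (t : ℝ) : Continuous fun x => g (x, t) := by
  fun_prop

theorem continuous_curry_right (g : C(ℝ × ℝ, ℝ)) (x : ℝ) : Continuous fun t => g (x, t) := by
  fun_prop

theorem continuous_primX :
    Continuous fun z : C(ℝ × ℝ, ℝ) × ℝ × ℝ => ∫ ξ in (0 : ℝ)..z.2.1, z.1 (ξ, z.2.2) :=
  intervalIntegral.continuous_parametric_intervalIntegral_of_continuous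
    (f := fun (z : C(ℝ × ℝ, ℝ) × ℝ × ℝ) ξ => z.1 (ξ, z.2.2)) (by fun_prop) (by fun_prop)

/-- The primitive in `x`, as an operator on continuous functions. -/
noncomputable def primXC : C(ℝ × ℝ, ℝ) →L[ℝ] C(ℝ × ℝ, ℝ) where
  toFun g := ⟨fun q => ∫ ξ in (0 : ℝ)..q.1, g (ξ, q.2),
    continuous_primX.comp (Continuous.prodMk_right g)⟩
  map_add' f g := ContinuousMap.ext fun q => intervalIntegral.integral_add
    ((continuous_curry_left f q.2).intervalIntegrable _ _)
    ((continuous_curry_left g q.2).intervalIntegrable _ _)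
  map_smul' _ _ := ContinuousMap.ext fun _ => intervalIntegral.integral_const_mul _ _
  cont := ContinuousMap.continuous_of_continuous_uncurry _ continuous_primX

/-- The primitive in `t`, as an operator on continuous functions. -/
noncomputable def primTC : C(ℝ × ℝ, ℝ) →L[ℝ] C(ℝ × ℝ, ℝ) :=
  ContinuousMap.compCLM ℝ ℝ ContinuousMap.prodSwap ∘L primXC ∘L
    ContinuousMap.compCLM ℝ ℝ ContinuousMap.prodSwap

/-- The restriction to `x = 1`. -/
noncomputable def evalOneC : C(ℝ × ℝ, ℝ) →L[ℝ] C(ℝ × ℝ, ℝ) :=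
  ContinuousMap.compCLM ℝ ℝ ⟨fun q : ℝ × ℝ => ((1 : ℝ), q.2), by fun_prop⟩

/-- Multiplication by `x`. -/
def mulXC : C(ℝ × ℝ, ℝ) →L[ℝ] C(ℝ × ℝ, ℝ) where
  toFun g := ContinuousMap.fst * g
  map_add' f g := mul_add _ f g
  map_smul' c g := mul_smul_comm c _ g
  cont := continuous_const_mul _

/-- The solution of `∂²w/∂x² = g` with `w = 0` for `x = 0` and `x = 1`. -/
noncomputable def greenC : C(ℝ × ℝ, ℝ) →L[ℝ] C(ℝ × ℝ, ℝ) :=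
  primXC ∘L primXC - mulXC ∘L evalOneC ∘L primXC ∘L primXC

/-- The derivative in `x` of `greenC`. -/
noncomputable def greenDerivC : C(ℝ × ℝ, ℝ) →L[ℝ] C(ℝ × ℝ, ℝ) :=
  primXC - evalOneC ∘L primXC ∘L primXC

section IntegralOperators

variable (g : C(ℝ × ℝ, ℝ)) (x t : ℝ)

theorem primXC_apply : primXC g (x, t) = ∫ ξ in (0 : ℝ)..x, g (ξ, t) := rfl

theorem primTC_apply : primTC g (x, t) = ∫ τ in (0 : ℝ)..t, g (x, τ) := rfl

theorem greenC_apply :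
    greenC g (x, t) = primXC (primXC g) (x, t) - x * primXC (primXC g) (1, t) := rfl

theorem greenDerivC_apply :
    greenDerivC g (x, t) = primXC g (x, t) - primXC (primXC g) (1, t) := rfl

theorem hasDerivAt_primXC : HasDerivAt (fun y => primXC g (y, t)) (g (x, t)) x :=
  (continuous_curry_left g t).integral_hasStrictDerivAt 0 x |>.hasDerivAt

theorem hasDerivAt_primTC : HasDerivAt (fun s => primTC g (x, s)) (g (x, t)) t :=
  (continuous_curry_right g x).integral_hasStrictDerivAt 0 t |>.hasDerivAt

theorem hasDerivAt_greenC : HasDerivAt (fun y => greenC g (y, t)) (greenDerivC g (x, t)) x := by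
  have h := (hasDerivAt_primXC (primXC g) x t).sub
    ((hasDerivAt_id x).mul_const (primXC (primXC g) (1, t)))
  rwa [one_mul] at h

theorem hasDerivAt_greenDerivC : HasDerivAt (fun y => greenDerivC g (y, t)) (g (x, t)) x :=
  (hasDerivAt_primXC g x t).sub_const (primXC (primXC g) (1, t))

theorem primXC_primTC : primXC (primTC g) = primTC (primXC g) :=
  ContinuousMap.ext fun _ => intervalIntegral_intervalIntegral_swap (F := fun x t => g (x, t))
    ((g.continuous.continuousOn.integrableOn_compact (isCompact_uIcc.prod isCompact_uIcc)).mono_set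
      (prod_mono uIoc_subset_uIcc uIoc_subset_uIcc))

theorem evalOneC_primTC : evalOneC (primTC g) = primTC (evalOneC g) := rfl

theorem mulXC_primTC : mulXC (primTC g) = primTC (mulXC g) :=
  ContinuousMap.ext fun _ => (intervalIntegral.integral_const_mul _ _).symm

theorem greenC_primTC : greenC (primTC g) = primTC (greenC g) := by
  simp only [greenC, sub_apply, ContinuousLinearMap.comp_apply, primXC_primTC,
    evalOneC_primTC, mulXC_primTC, map_sub]

theorem greenC_zero : greenC g (0, t) = 0 := by
  simp [greenC_apply, primXC_apply]

theorem greenC_one : greenC g (1, t) = 0 := by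
  simp [greenC_apply]

theorem primTC_zero : primTC g (x, 0) = 0 := by
  simp [primTC_apply]

end IntegralOperators

/-! ### Recovering a function from its highest mixed derivative -/

/-- Equality as functions on the rectangle `Ω`. -/
def EqOmega (T : ℝ) (f g : ℝ → ℝ → ℝ) : Prop :=
  ∀ x ∈ Icc (0 : ℝ) 1, ∀ t ∈ Icc (0 : ℝ) T, f x t = g x t

theorem EqOmega.refl {T : ℝ} (f : ℝ → ℝ → ℝ) : EqOmega T f f := fun _ _ _ _ => rfl

theorem dx_congr {T : ℝ} {f g : ℝ → ℝ → ℝ} (h : EqOmega T f g) : EqOmega T (dx f) (dx g) :=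
  fun x hx t ht => derivWithin_congr (fun y hy => h y hy t ht) (h x hx t ht)

theorem dt_congr {T : ℝ} {f g : ℝ → ℝ → ℝ} (h : EqOmega T f g) : EqOmega T (dt T f) (dt T g) :=
  fun x hx t ht => derivWithin_congr (fun s hs => h x hx s hs) (h x hx t ht)

theorem D_succ_left (T : ℝ) (i j : ℕ) (u : ℝ → ℝ → ℝ) : D T (i + 1) j u = dx (D T i j u) :=
  Function.iterate_succ_apply' _ _ _

theorem D_zero_succ (T : ℝ) (j : ℕ) (u : ℝ → ℝ → ℝ) : D T 0 (j + 1) u = dt T (D T 0 j u) :=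
  Function.iterate_succ_apply' _ _ _

theorem D_congr {T : ℝ} {f g : ℝ → ℝ → ℝ} (h : EqOmega T f g) (i j : ℕ) :
    EqOmega T (D T i j f) (D T i j g) := by
  induction i with
  | zero =>
    induction j with
    | zero => exact h
    | succ j ih => rw [D_zero_succ, D_zero_succ]; exact dt_congr ih
  | succ i ih => rw [D_succ_left, D_succ_left]; exact dx_congr ih

theorem eq_of_hasDerivWithinAt_zero {l : ℝ} (hl : 0 < l) {g : ℝ → ℝ}
    (h : ∀ x ∈ Icc (0 : ℝ) l, HasDerivWithinAt g 0 (Icc 0 l) x) :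
    ∀ x ∈ Icc (0 : ℝ) l, g x = g 0 :=
  constant_of_derivWithin_zero (fun x hx => (h x hx).differentiableWithinAt) fun x hx =>
    (h x ⟨hx.1, hx.2.le⟩).derivWithin (uniqueDiffOn_Icc hl x ⟨hx.1, hx.2.le⟩)

theorem eq_zero_of_hasDerivWithinAt_twice {g g' : ℝ → ℝ} (h0 : g 0 = 0) (h1 : g 1 = 0)
    (hg : ∀ x ∈ Icc (0 : ℝ) 1, HasDerivWithinAt g (g' x) (Icc 0 1) x)
    (hg' : ∀ x ∈ Icc (0 : ℝ) 1, HasDerivWithinAt g' 0 (Icc 0 1) x) :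
    ∀ x ∈ Icc (0 : ℝ) 1, g x = 0 := by
  have hconst := eq_of_hasDerivWithinAt_zero one_pos hg'
  have hlin : ∀ x ∈ Icc (0 : ℝ) 1, g x - x * g' 0 = g 0 - 0 * g' 0 :=
    eq_of_hasDerivWithinAt_zero (g := fun x => g x - x * g' 0) one_pos fun x hx => by
      have h := (hg x hx).sub ((hasDerivWithinAt_id x (Icc 0 1)).mul_const (g' 0))
      rwa [hconst x hx, one_mul, sub_self] at h
  intro x hx
  have hslope := hlin 1 (right_mem_Icc.2 zero_le_one)
  have hx' := hlin x hx
  simp only [h0, h1, one_mul, zero_mul, sub_zero, zero_sub, neg_eq_zero] at hslope hx'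
  rwa [hslope, mul_zero, sub_zero] at hx'

/-- A family `u i j` that behaves like the derivatives `∂^{i+j}u/∂x^i∂t^j` of a function with
homogeneous initial and boundary values. -/
structure IsDerivFamily (T : ℝ) (u : ℕ → ℕ → ℝ → ℝ → ℝ) : Prop where
  deriv_t : ∀ j < 2, ∀ x ∈ Icc (0 : ℝ) 1, ∀ t ∈ Icc (0 : ℝ) T,
    HasDerivWithinAt (u 0 j x) (u 0 (j + 1) x t) (Icc 0 T) t
  deriv_x : ∀ i < 2, ∀ j ≤ 2, ∀ x ∈ Icc (0 : ℝ) 1, ∀ t ∈ Icc (0 : ℝ) T,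
    HasDerivWithinAt (fun y => u i j y t) (u (i + 1) j x t) (Icc 0 1) x
  initial : ∀ x ∈ Icc (0 : ℝ) 1, u 0 0 x 0 = 0 ∧ u 0 1 x 0 = 0
  boundary : ∀ t ∈ Icc (0 : ℝ) T, u 0 0 0 t = 0 ∧ u 0 0 1 t = 0

namespace IsDerivFamily

variable {T : ℝ} {u w : ℕ → ℕ → ℝ → ℝ → ℝ}

theorem sub (hu : IsDerivFamily T u) (hw : IsDerivFamily T w) :
    IsDerivFamily T (fun i j x t => u i j x t - w i j x t) where
  deriv_t j hj x hx t ht := (hu.deriv_t j hj x hx t ht).sub (hw.deriv_t j hj x hx t ht)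
  deriv_x i hi j hj x hx t ht :=
    (hu.deriv_x i hi j hj x hx t ht).sub (hw.deriv_x i hi j hj x hx t ht)
  initial x hx := by simp [hu.initial x hx, hw.initial x hx]
  boundary t ht := by simp [hu.boundary t ht, hw.boundary t ht]

theorem D_eq (hu : IsDerivFamily T u) (hT : 0 < T) {i j : ℕ} (hi : i ≤ 2) (hj : j ≤ 2) :
    EqOmega T (D T i j (u 0 0)) (u i j) := by
  induction i with
  | zero =>
    induction j with
    | zero => exact fun _ _ _ _ => rfl
    | succ j ih =>
      intro x hx t ht
      rw [D_zero_succ, dt_congr (ih (by omega)) x hx t ht]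
      exact (hu.deriv_t j (by omega) x hx t ht).derivWithin (uniqueDiffOn_Icc hT t ht)
  | succ i ih =>
    intro x hx t ht
    rw [D_succ_left, dx_congr (ih (by omega)) x hx t ht]
    exact (hu.deriv_x i (by omega) j hj x hx t ht).derivWithin (uniqueDiffOn_Icc one_pos x hx)

theorem boundary_eq_zero (hu : IsDerivFamily T u) (hT : 0 < T) {x : ℝ} (hx : x = 0 ∨ x = 1)
    {j : ℕ} (hj : j ≤ 2) : ∀ t ∈ Icc (0 : ℝ) T, u 0 j x t = 0 := by
  have hxm : x ∈ Icc (0 : ℝ) 1 := by rcases hx with rfl | rfl <;> simp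
  induction j with
  | zero =>
    intro t ht
    rcases hx with rfl | rfl
    exacts [(hu.boundary t ht).1, (hu.boundary t ht).2]
  | succ j ih =>
    intro t ht
    have hzero : HasDerivWithinAt (u 0 j x) 0 (Icc 0 T) t :=
      (hasDerivWithinAt_const t (Icc 0 T) (0 : ℝ)).congr_of_mem (ih (by omega)) ht
    exact (uniqueDiffOn_Icc hT t ht).eq_deriv _ (hu.deriv_t j (by omega) x hxm t ht) hzero

theorem eq_zero_of_succ (hu : IsDerivFamily T u) (hT : 0 < T) {j : ℕ} (hj : j < 2)
    (h : ∀ x ∈ Icc (0 : ℝ) 1, ∀ t ∈ Icc (0 : ℝ) T, u 0 (j + 1) x t = 0) :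
    ∀ x ∈ Icc (0 : ℝ) 1, ∀ t ∈ Icc (0 : ℝ) T, u 0 j x t = 0 := fun x hx t ht => by
  rw [eq_of_hasDerivWithinAt_zero hT (g := u 0 j x)
    (fun s hs => h x hx s hs ▸ hu.deriv_t j hj x hx s hs) t ht]
  interval_cases j
  exacts [(hu.initial x hx).1, (hu.initial x hx).2]

theorem eq_zero (hu : IsDerivFamily T u) (hT : 0 < T)
    (h22 : ∀ x ∈ Icc (0 : ℝ) 1, ∀ t ∈ Icc (0 : ℝ) T, u 2 2 x t = 0) :
    ∀ x ∈ Icc (0 : ℝ) 1, ∀ t ∈ Icc (0 : ℝ) T, u 0 0 x t = 0 :=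
  hu.eq_zero_of_succ hT two_pos <| hu.eq_zero_of_succ hT one_lt_two fun x hx t ht =>
    eq_zero_of_hasDerivWithinAt_twice
      (hu.boundary_eq_zero hT (Or.inl rfl) le_rfl t ht)
      (hu.boundary_eq_zero hT (Or.inr rfl) le_rfl t ht)
      (fun x hx => hu.deriv_x 0 two_pos 2 le_rfl x hx t ht)
      (fun x hx => h22 x hx t ht ▸ hu.deriv_x 1 one_lt_two 2 le_rfl x hx t ht) x hx

end IsDerivFamily

/-- The derivatives `∂^{i+j}u/∂x^i∂t^j`, `i, j ≤ 2`, of the function `u` with homogeneous initial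
and boundary values and `∂⁴u/∂x²∂t² = F`. -/
noncomputable def reconFamily (F : C(ℝ × ℝ, ℝ)) (i j : ℕ) : C(ℝ × ℝ, ℝ) :=
  match i with
  | 0 => greenC (primTC^[2 - j] F)
  | 1 => greenDerivC (primTC^[2 - j] F)
  | _ => primTC^[2 - j] F

/-- The function with homogeneous initial and boundary values and `∂⁴u/∂x²∂t² = F`. -/
noncomputable def recon (F : C(ℝ × ℝ, ℝ)) : ℝ → ℝ → ℝ :=
  fun x t => greenC (primTC (primTC F)) (x, t)

theorem isDerivFamily_recon (T : ℝ) (F : C(ℝ × ℝ, ℝ)) :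
    IsDerivFamily T (fun i j x t => reconFamily F i j (x, t)) where
  deriv_t j hj x _ t _ := by
    refine HasDerivAt.hasDerivWithinAt ?_
    interval_cases j
    · change HasDerivAt (fun s => greenC (primTC (primTC F)) (x, s)) (greenC (primTC F) (x, t)) t
      rw [greenC_primTC]
      exact hasDerivAt_primTC _ x t
    · change HasDerivAt (fun s => greenC (primTC F) (x, s)) (greenC F (x, t)) t
      rw [greenC_primTC]
      exact hasDerivAt_primTC _ x t
  deriv_x i hi j _ x _ t _ := by
    refine HasDerivAt.hasDerivWithinAt ?_
    interval_cases i
    · exact hasDerivAt_greenC _ x t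
    · exact hasDerivAt_greenDerivC _ x t
  initial x _ := by
    constructor
    · change greenC (primTC (primTC F)) (x, 0) = 0
      rw [greenC_primTC, primTC_zero]
    · change greenC (primTC F) (x, 0) = 0
      rw [greenC_primTC, primTC_zero]
  boundary t _ := ⟨greenC_zero _ t, greenC_one _ t⟩

theorem IsDerivFamily.eq_recon {T : ℝ} {u : ℕ → ℕ → ℝ → ℝ → ℝ} (hu : IsDerivFamily T u)
    (hT : 0 < T) {F : C(ℝ × ℝ, ℝ)}
    (hF : EqOmega T (u 2 2) fun x t => F (x, t)) :
    EqOmega T (u 0 0) (recon F) := fun x hx t ht =>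
  sub_eq_zero.1 ((hu.sub (isDerivFamily_recon T F)).eq_zero hT
    (fun x hx t ht => sub_eq_zero.2 (hF x hx t ht)) x hx t ht)

theorem D_recon {T : ℝ} (hT : 0 < T) (F : C(ℝ × ℝ, ℝ)) {i j : ℕ} (hi : i ≤ 2) (hj : j ≤ 2) :
    ∀ x ∈ Icc (0 : ℝ) 1, ∀ t ∈ Icc (0 : ℝ) T, D T i j (recon F) x t = reconFamily F i j (x, t) :=
  (isDerivFamily_recon T F).D_eq hT hi hj

theorem waveOp_recon {T : ℝ} (hT : 0 < T) (F : C(ℝ × ℝ, ℝ)) :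
    ∀ x ∈ Icc (0 : ℝ) 1, ∀ t ∈ Icc (0 : ℝ) T,
      waveOp T (recon F) x t = greenC F (x, t) - primTC (primTC F) (x, t) := fun x hx t ht => by
  rw [waveOp, D_recon hT F zero_le_two le_rfl x hx t ht, D_recon hT F le_rfl zero_le_two x hx t ht]
  rfl

theorem MemW.isDerivFamily {T : ℝ} {u : ℝ → ℝ → ℝ} (hu : MemW T u) :
    IsDerivFamily T (fun i j => D T i j u) where
  deriv_t j hj x hx t ht := by
    simp only [D_zero_succ]
    exact (hu.diff_t j hj x hx t ht).hasDerivWithinAt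
  deriv_x i hi j hj x hx t ht := by
    simp only [D_succ_left]
    exact (hu.diff_x i hi j hj x hx t ht).hasDerivWithinAt
  initial := hu.initial
  boundary := hu.boundary

theorem iteratedDerivWithin_three (T : ℝ) (j : ℕ) (u : ℝ → ℝ → ℝ) :
    iteratedDerivWithin 3 (fun x => D T 0 j u x 0) (Icc 0 1) = fun x => dx (D T 2 j u) x 0 := by
  ext x
  rw [iteratedDerivWithin_eq_iterate]
  rfl

theorem MemW.memHatW {T : ℝ} {u : ℝ → ℝ → ℝ} (hu : MemW T u) : MemHatW T (D T 2 2 u) where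
  completelyContinuous := hu.completelyContinuous
  memLp_top := hu.memLp_top
  memLp_left := hu.memLp_left 2 le_rfl
  memLp_bottom := iteratedDerivWithin_three T 2 u ▸ hu.memLp_bottom 2 le_rfl

theorem intervalIntegrable_of_integrableOn_Icc {l x : ℝ} {a : ℝ → ℝ} (ha : IntegrableOn a (Icc 0 l))
    (hx : x ∈ Icc 0 l) : IntervalIntegrable a volume 0 x :=
  (intervalIntegrable_iff_integrableOn_Icc_of_le hx.1).2 (ha.mono_set (Icc_subset_Icc_right hx.2))

theorem integral_pow_mul_primitive {g : ℝ → ℝ} (hg : IntegrableOn g I) (n : ℕ) :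
    ∫ x in (0 : ℝ)..1, (1 - x) ^ n * ∫ ξ in (0 : ℝ)..x, g ξ =
      ∫ x in (0 : ℝ)..1, (1 - x) ^ (n + 1) / (n + 1) * g x := by
  have hint := intervalIntegrable_of_integrableOn_Icc hg (right_mem_Icc.2 zero_le_one)
  have hweight : ∀ x : ℝ,
      HasDerivAt (fun x : ℝ => -((1 - x) ^ (n + 1) / (n + 1))) ((1 - x) ^ n) x := fun x => by
    have h := ((((hasDerivAt_id x).const_sub 1).pow (n + 1)).div_const (n + 1 : ℝ)).neg
    refine h.congr_deriv ?_
    simp only [id_eq, Nat.add_sub_cancel]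
    push_cast
    field_simp
  have hac : AbsolutelyContinuousOnInterval (fun x : ℝ => -((1 - x) ^ (n + 1) / (n + 1))) 0 1 :=
    ContDiffOn.absolutelyContinuousOnInterval (by fun_prop)
  have hparts := hac.integral_mul_deriv_eq_deriv_mul
    (hint.absolutelyContinuousOnInterval_intervalIntegral left_mem_uIcc)
  have hderiv : ∀ᵐ x : ℝ, x ∈ uIoc 0 1 → deriv (fun x => ∫ ξ in (0 : ℝ)..x, g ξ) x = g x := by
    filter_upwards [hint.ae_hasDerivAt_integral] with x hx hxI
    exact (hx (uIoc_subset_uIcc hxI) 0 left_mem_uIcc).deriv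
  have hlhs : ∫ x in (0 : ℝ)..1, -((1 - x) ^ (n + 1) / (n + 1)) *
      deriv (fun x => ∫ ξ in (0 : ℝ)..x, g ξ) x =
      -∫ x in (0 : ℝ)..1, (1 - x) ^ (n + 1) / (n + 1) * g x := by
    rw [← intervalIntegral.integral_neg]
    exact intervalIntegral.integral_congr_ae (hderiv.mono fun x hx hxI => by rw [hx hxI, neg_mul])
  rw [hlhs] at hparts
  simp only [(hweight _).deriv, sub_self, zero_pow n.succ_ne_zero, zero_div, neg_zero, zero_mul,
    intervalIntegral.integral_same, mul_zero, zero_sub, neg_inj] at hparts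
  exact hparts.symm

section Operations

variable {T : ℝ} {f g : ℝ → ℝ → ℝ} {a b a' b' : ℝ → ℝ} {h h' : ℝ → ℝ → ℝ}

theorem integrableOn_primX (hh : IntegrableOn (fun q : ℝ × ℝ => h q.1 q.2) (Omega T)) {x : ℝ}
    (hx : x ∈ Icc (0 : ℝ) 1) : IntegrableOn (primX h x) (Icc 0 T) := by
  refine ((ContinuousMap.evalCLM ℝ (⟨x, hx⟩ : I)).integrable_comp
    (integrable_primC (integrable_swap hh))).congr ?_
  filter_upwards [(integrable_swap hh).prod_right_ae] with t ht using primC_apply ht ⟨x, hx⟩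

theorem integrableOn_primT (hh : IntegrableOn (fun q : ℝ × ℝ => h q.1 q.2) (Omega T)) {t : ℝ}
    (ht : t ∈ Icc (0 : ℝ) T) : IntegrableOn (fun x => primT h x t) I := by
  have hh' : IntegrableOn (fun q : ℝ × ℝ => h q.1 q.2) (Omega t) :=
    hh.mono_set (prod_mono_right (Icc_subset_Icc_right ht.2))
  rw [IntegrableOn, restrict_Omega] at hh'
  simp only [primT, intervalIntegral_eq_integral_leb ht.1]
  exact hh'.integral_prod_left

theorem primX_primT_sub (hh : IntegrableOn (fun q : ℝ × ℝ => h q.1 q.2) (Omega T))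
    (hh' : IntegrableOn (fun q : ℝ × ℝ => h' q.1 q.2) (Omega T)) {x t : ℝ}
    (hx : x ∈ Icc (0 : ℝ) 1) (ht : t ∈ Icc (0 : ℝ) T) :
    primX (primT fun x t => h x t - h' x t) x t = primX (primT h) x t - primX (primT h') x t := by
  have hbox : ∀ {k : ℝ → ℝ → ℝ}, IntegrableOn (fun q : ℝ × ℝ => k q.1 q.2) (Omega T) →
      primX (primT k) x t = ∫ q in uIoc 0 x ×ˢ uIoc 0 t, k q.1 q.2 := fun hk => by
    have hk' := hk.mono_set (uIoc_prod_subset_Omega hx ht)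
    rw [uIoc_of_le hx.1, uIoc_of_le ht.1] at hk' ⊢
    rw [Measure.volume_eq_prod, setIntegral_prod _ hk']
    simp only [primX, primT, intervalIntegral.integral_of_le hx.1,
      intervalIntegral.integral_of_le ht.1]
  rw [hbox hh, hbox hh', hbox (hh.sub hh')]
  exact integral_sub (hh.mono_set (uIoc_prod_subset_Omega hx ht))
    (hh'.mono_set (uIoc_prod_subset_Omega hx ht))

theorem IsL2Primitive.sub (hf : IsL2Primitive T f a b h) (hg : IsL2Primitive T g a' b' h') :
    IsL2Primitive T (fun x t => f x t - g x t) (fun x => a x - a' x) (fun t => b t - b' t)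
      (fun x t => h x t - h' x t) where
  a_memLp := hf.a_memLp.sub hg.a_memLp
  b_memLp := hf.b_memLp.sub hg.b_memLp
  h_memLp := hf.h_memLp.sub hg.h_memLp
  prim x hx t ht := by
    have htop := primX_primT_sub hf.h_int hg.h_int hx ht
    simp only [primX, primT] at htop
    beta_reduce
    rw [htop, hf.prim x hx t ht, hg.prim x hx t ht,
      intervalIntegral.integral_sub (intervalIntegrable_of_integrableOn_Icc hf.a_int hx)
        (intervalIntegrable_of_integrableOn_Icc hg.a_int hx),
      intervalIntegral.integral_sub (intervalIntegrable_of_integrableOn_Icc hf.b_int ht)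
        (intervalIntegrable_of_integrableOn_Icc hg.b_int ht)]
    ring

theorem IsL2Primitive.congr (hf : IsL2Primitive T f a b h) (hT : 0 ≤ T)
    (hgf : EqOmega T g f) : IsL2Primitive T g a b h where
  a_memLp := hf.a_memLp
  b_memLp := hf.b_memLp
  h_memLp := hf.h_memLp
  prim x hx t ht := by
    rw [hgf x hx t ht, hgf 0 (left_mem_Icc.2 zero_le_one) 0 (left_mem_Icc.2 hT)]
    exact hf.prim x hx t ht

/-- The derivative in `t` of a double primitive with data `b`, `h`. -/
noncomputable def primDt (b : ℝ → ℝ) (h : ℝ → ℝ → ℝ) : ℝ → ℝ → ℝ := fun x t => b t + primX h x t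

/-- The derivative in `x` of a double primitive with data `a`, `h`. -/
noncomputable def primDx (a : ℝ → ℝ) (h : ℝ → ℝ → ℝ) : ℝ → ℝ → ℝ := fun x t => a x + primT h x t

theorem IsL2Primitive.memLp_primDt (hf : IsL2Primitive T f a b h) :
    MemLp (fun q : ℝ × ℝ => primDt b h q.1 q.2) 2 ((leb 1).prod (leb T)) :=
  (hf.b_memLp.comp_snd (leb 1)).add (memLp_primX hf.h_memLp)

theorem IsL2Primitive.memLp_primDx (hf : IsL2Primitive T f a b h) :
    MemLp (fun q : ℝ × ℝ => primDx a h q.1 q.2) 2 ((leb 1).prod (leb T)) :=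
  (hf.a_memLp.comp_fst (leb T)).add (memLp_primT hf.h_memLp)

theorem IsL2Primitive.eq_add_primT (hf : IsL2Primitive T f a b h) {x t : ℝ}
    (hx : x ∈ Icc (0 : ℝ) 1) (ht : t ∈ Icc (0 : ℝ) T) :
    f x t = f x 0 + primT (primDt b h) x t := by
  have hsplit : primT (primDt b h) x t = (∫ τ in (0 : ℝ)..t, b τ) + primT (primX h) x t :=
    intervalIntegral.integral_add (intervalIntegrable_of_integrableOn_Icc hf.b_int ht)
      (intervalIntegrable_of_integrableOn_Icc (integrableOn_primX hf.h_int hx) ht)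
  rw [hsplit, ← primX_primT_comm hf.h_int hx ht, hf.prim x hx t ht,
    hf.prim x hx 0 ⟨le_rfl, ht.1.trans ht.2⟩]
  simp only [intervalIntegral.integral_same, intervalIntegral.integral_zero, primX, primT]
  ring

theorem IsL2Primitive.eq_add_primX (hf : IsL2Primitive T f a b h) {x t : ℝ}
    (hx : x ∈ Icc (0 : ℝ) 1) (ht : t ∈ Icc (0 : ℝ) T) :
    f x t = f 0 t + primX (primDx a h) x t := by
  have hsplit : primX (primDx a h) x t = (∫ τ in (0 : ℝ)..x, a τ) + primX (primT h) x t :=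
    intervalIntegral.integral_add (intervalIntegrable_of_integrableOn_Icc hf.a_int hx)
      (intervalIntegrable_of_integrableOn_Icc (integrableOn_primT hf.h_int ht) hx)
  rw [hsplit, hf.prim x hx t ht, hf.prim 0 (left_mem_Icc.2 zero_le_one) t ht]
  simp only [intervalIntegral.integral_same, primX, primT]
  ring

end Operations

section PrimitivesOfContinuous

variable {g : C(ℝ × ℝ, ℝ)} {T : ℝ} {k : ℝ → ℝ → ℝ}

theorem primXC_sub_eq
    (hg : ∀ x ∈ Icc (0 : ℝ) 1, ∀ t ∈ Icc (0 : ℝ) T, g (x, t) = g (x, 0) + primT k x t)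
    {x t : ℝ} (hx : x ∈ Icc (0 : ℝ) 1) (ht : t ∈ Icc (0 : ℝ) T) :
    primXC g (x, t) = primXC g (x, 0) + primX (primT k) x t := by
  have hdiff : primX (primT k) x t = ∫ ξ in (0 : ℝ)..x, (g (ξ, t) - g (ξ, 0)) := by
    refine intervalIntegral.integral_congr fun ξ hξ => ?_
    rw [uIcc_of_le hx.1] at hξ
    exact (sub_eq_of_eq_add' (hg ξ ⟨hξ.1, hξ.2.trans hx.2⟩ t ht)).symm
  rw [hdiff, intervalIntegral.integral_sub ((continuous_curry_left g t).intervalIntegrable _ _)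
    ((continuous_curry_left g 0).intervalIntegrable _ _), primXC_apply, primXC_apply]
  ring

theorem primTC_sub_eq
    (hg : ∀ x ∈ Icc (0 : ℝ) 1, ∀ t ∈ Icc (0 : ℝ) T, g (x, t) = g (0, t) + primX k x t)
    {x t : ℝ} (hx : x ∈ Icc (0 : ℝ) 1) (ht : t ∈ Icc (0 : ℝ) T) :
    primTC g (x, t) = primTC g (0, t) + primT (primX k) x t := by
  have hdiff : primT (primX k) x t = ∫ τ in (0 : ℝ)..t, (g (x, τ) - g (0, τ)) := by
    refine intervalIntegral.integral_congr fun τ hτ => ?_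
    rw [uIcc_of_le ht.1] at hτ
    exact (sub_eq_of_eq_add' (hg x hx τ ⟨hτ.1, hτ.2.trans ht.2⟩)).symm
  rw [hdiff, intervalIntegral.integral_sub ((continuous_curry_right g x).intervalIntegrable _ _)
    ((continuous_curry_right g 0).intervalIntegrable _ _), primTC_apply, primTC_apply]
  ring

theorem primXC_eq (hk : IntegrableOn (fun q : ℝ × ℝ => k q.1 q.2) (Omega T))
    (hg : ∀ x ∈ Icc (0 : ℝ) 1, ∀ t ∈ Icc (0 : ℝ) T, g (x, t) = g (x, 0) + primT k x t) :
    ∀ x ∈ Icc (0 : ℝ) 1, ∀ t ∈ Icc (0 : ℝ) T,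
      primXC g (x, t) = primXC g (x, 0) + primT (primX k) x t := fun x hx t ht => by
  rw [primXC_sub_eq hg hx ht, primX_primT_comm hk hx ht]

theorem primTC_eq (hk : IntegrableOn (fun q : ℝ × ℝ => k q.1 q.2) (Omega T))
    (hg : ∀ x ∈ Icc (0 : ℝ) 1, ∀ t ∈ Icc (0 : ℝ) T, g (x, t) = g (0, t) + primX k x t) :
    ∀ x ∈ Icc (0 : ℝ) 1, ∀ t ∈ Icc (0 : ℝ) T,
      primTC g (x, t) = primTC g (0, t) + primX (primT k) x t := fun x hx t ht => by
  rw [primTC_sub_eq hg hx ht, primX_primT_comm hk hx ht]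

end PrimitivesOfContinuous

theorem memLp_of_continuous {l : ℝ} {g : ℝ → ℝ} (hg : Continuous g) : MemLp g 2 (leb l) := by
  obtain ⟨C, hC⟩ := isCompact_Icc.exists_bound_of_continuousOn (s := Icc 0 l) hg.continuousOn
  refine MemLp.of_bound hg.aestronglyMeasurable C ?_
  filter_upwards [ae_restrict_mem measurableSet_Icc] with x hx using hC x hx

theorem memLp_primX_one {T : ℝ} {k : ℝ → ℝ → ℝ}
    (hk : MemLp (fun q : ℝ × ℝ => k q.1 q.2) 2 ((leb 1).prod (leb T))) :
    MemLp (primX k 1) 2 (leb T) := by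
  have hint := memLp_integral_mul (memLp_const (1 : ℝ)) hk
  simp only [one_mul, ← intervalIntegral_eq_integral_leb zero_le_one] at hint
  exact hint

section Recon

variable {T : ℝ} {F : C(ℝ × ℝ, ℝ)} {a b : ℝ → ℝ} {h : ℝ → ℝ → ℝ}

theorem IsL2Primitive.primXC_primXC_eq (hF : IsL2Primitive T (fun x t => F (x, t)) a b h) :
    ∀ x ∈ Icc (0 : ℝ) 1, ∀ t ∈ Icc (0 : ℝ) T, primXC (primXC F) (x, t) =
      primXC (primXC F) (x, 0) + primT (primX (primX (primDt b h))) x t :=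
  primXC_eq (integrableOn_Omega_of_memLp (memLp_primX hF.memLp_primDt))
    (primXC_eq (integrableOn_Omega_of_memLp hF.memLp_primDt) fun _ hx _ ht => hF.eq_add_primT hx ht)

theorem isL2Primitive_primXC_primXC (hF : IsL2Primitive T (fun x t => F (x, t)) a b h) :
    IsL2Primitive T (fun x t => primXC (primXC F) (x, t)) (fun x => primXC F (x, 0)) (fun _ => 0)
      (primX (primDt b h)) where
  a_memLp := memLp_of_continuous (continuous_curry_left _ _)
  b_memLp := memLp_const 0
  h_memLp := memLp_primX hF.memLp_primDt
  prim x hx t ht := by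
    beta_reduce
    rw [primXC_sub_eq (primXC_eq (integrableOn_Omega_of_memLp hF.memLp_primDt)
      fun _ hx _ ht => hF.eq_add_primT hx ht) hx ht]
    simp [primXC_apply, primX, primT]

theorem isL2Primitive_greenC (hF : IsL2Primitive T (fun x t => F (x, t)) a b h) :
    ∃ a' b' h', IsL2Primitive T (fun x t => greenC F (x, t)) a' b' h' := by
  have hone : IsL2Primitive T (fun x t => x * primXC (primXC F) (1, t))
      (fun _ => primXC (primXC F) (1, 0)) (fun _ => 0)
      (fun _ t => primX (primX (primDt b h)) 1 t) :=
    { a_memLp := memLp_const _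
      b_memLp := memLp_const 0
      h_memLp := (memLp_primX_one (memLp_primX hF.memLp_primDt)).comp_snd (leb 1)
      prim := fun x _ t ht => by
        beta_reduce
        rw [hF.primXC_primXC_eq 1 (right_mem_Icc.2 zero_le_one) t ht]
        simp only [intervalIntegral.integral_const, smul_eq_mul, primT]
        ring }
  exact ⟨_, _, _, (isL2Primitive_primXC_primXC hF).sub hone⟩

theorem isL2Primitive_primTC_primTC (hF : IsL2Primitive T (fun x t => F (x, t)) a b h) :
    IsL2Primitive T (fun x t => primTC (primTC F) (x, t)) (fun _ => 0) (fun t => primTC F (0, t))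
      (primT (primDx a h)) where
  a_memLp := memLp_const 0
  b_memLp := memLp_of_continuous (continuous_curry_right _ _)
  h_memLp := memLp_primT hF.memLp_primDx
  prim x hx t ht := by
    beta_reduce
    rw [primTC_sub_eq (primTC_eq (integrableOn_Omega_of_memLp hF.memLp_primDx)
      fun _ hx _ ht => hF.eq_add_primX hx ht) hx ht,
      ← primX_primT_comm (integrableOn_Omega_of_memLp (memLp_primT hF.memLp_primDx)) hx ht]
    simp [primTC_apply, primX, primT]

theorem memHatW_waveOp_recon (hF : IsL2Primitive T (fun x t => F (x, t)) a b h) (hT : 0 < T) :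
    MemHatW T (waveOp T (recon F)) := by
  obtain ⟨_, _, _, hgreen⟩ := isL2Primitive_greenC hF
  exact ((hgreen.sub (isL2Primitive_primTC_primTC hF)).congr hT.le (waveOp_recon hT F)).memHatW hT

/-- The derivative in `t` of `∂³u/∂x∂t²(0,t) = -∫₀¹ (1-ξ) ∂⁴u/∂x²∂t²(ξ,t) dξ`, in terms of the data
`b`, `h` of `∂⁴u/∂x²∂t²`. -/
noncomputable def slopeData (b : ℝ → ℝ) (h : ℝ → ℝ → ℝ) : ℝ → ℝ :=
  fun t => -(b t / 2 + ∫ ξ, (1 - ξ) ^ 2 / 2 * h ξ t ∂leb 1)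

theorem memLp_slopeWeight : MemLp (fun ξ : ℝ => (1 - ξ) ^ 2 / 2) 2 (leb 1) :=
  memLp_of_continuous (by fun_prop)

theorem IsL2Primitive.memLp_slopeData {f : ℝ → ℝ → ℝ} (hf : IsL2Primitive T f a b h) :
    MemLp (slopeData b h) 2 (leb T) :=
  ((hf.b_memLp.mul_const 2⁻¹).add (memLp_integral_mul memLp_slopeWeight hf.h_memLp)).neg

theorem IsL2Primitive.ae_primX_primX_primDt_one {f : ℝ → ℝ → ℝ} (hf : IsL2Primitive T f a b h) :
    ∀ᵐ t ∂leb T, primX (primX (primDt b h)) 1 t = -slopeData b h t := by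
  filter_upwards [(integrable_swap hf.h_int).prod_right_ae] with t ht
  have hprim : IntegrableOn (fun x => primX h x t) I :=
    (continuousOn_primitive_zero zero_le_one ht).integrableOn_compact isCompact_Icc
  have houter := integral_pow_mul_primitive (g := fun x => primDt b h x t)
    ((integrableOn_const (by simp)).add hprim) 0
  have hinner := integral_pow_mul_primitive (g := fun x => h x t) ht 1
  simp only [pow_zero, one_mul, zero_add, Nat.cast_zero, pow_one, div_one] at houter
  simp only [pow_one, Nat.cast_one, one_add_one_eq_two] at hinner
  have hsplit : ∫ x in (0 : ℝ)..1, (1 - x) * primDt b h x t =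
      (∫ x in (0 : ℝ)..1, (1 - x) * b t) + ∫ x in (0 : ℝ)..1, (1 - x) * primX h x t := by
    simp only [primDt, mul_add]
    refine intervalIntegral.integral_add (Continuous.intervalIntegrable (by fun_prop) _ _) ?_
    exact (intervalIntegrable_of_integrableOn_Icc hprim (right_mem_Icc.2 zero_le_one)
      ).continuousOn_mul (by fun_prop)
  have hmass : ∫ x in (0 : ℝ)..1, (1 - x) * b t = b t / 2 := by
    rw [intervalIntegral.integral_mul_const,
      intervalIntegral.integral_sub intervalIntegrable_const
        intervalIntegral.intervalIntegrable_id, integral_id, intervalIntegral.integral_const]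
    simp only [smul_eq_mul]
    ring
  rw [slopeData, neg_neg, ← intervalIntegral_eq_integral_leb zero_le_one, ← hinner, ← hmass]
  exact houter.trans hsplit

theorem dt_recon_zero (hT : 0 < T) {t : ℝ} (ht : t ∈ Icc 0 T) :
    dt T (D T 0 2 (recon F)) 0 t = 0 := by
  rw [dt_congr (D_recon hT F zero_le_two le_rfl) 0 (left_mem_Icc.2 zero_le_one) t ht]
  have hzero : ∀ s, reconFamily F 0 2 (0, s) = 0 := greenC_zero F
  simp [dt, hzero]

theorem ae_dt_recon_one (hF : IsL2Primitive T (fun x t => F (x, t)) a b h) (hT : 0 < T) :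
    ∀ᵐ t ∂leb T, dt T (D T 1 2 (recon F)) 0 t = slopeData b h t := by
  have hprim : ∀ t ∈ Icc (0 : ℝ) T, D T 1 2 (recon F) 0 t =
      greenDerivC F (0, 0) + ∫ τ in (0 : ℝ)..t, slopeData b h τ := fun t ht => by
    rw [D_recon hT F one_le_two le_rfl 0 (left_mem_Icc.2 zero_le_one) t ht]
    have hslope : primT (primX (primX (primDt b h))) 1 t = -∫ τ in (0 : ℝ)..t, slopeData b h τ := by
      rw [← intervalIntegral.integral_neg]
      refine intervalIntegral.integral_congr_ae_restrict ?_
      rw [uIoc_of_le ht.1]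
      exact ae_restrict_of_ae_restrict_of_subset
        (Ioc_subset_Icc_self.trans (Icc_subset_Icc_right ht.2)) hF.ae_primX_primX_primDt_one
    change greenDerivC F (0, t) = _
    rw [greenDerivC_apply, greenDerivC_apply,
      hF.primXC_primXC_eq 1 (right_mem_Icc.2 zero_le_one) t ht, hslope]
    simp only [primXC_apply, intervalIntegral.integral_same]
    ring
  filter_upwards [ae_hasDerivWithinAt_primitive hT.le (hF.memLp_slopeData.integrable one_le_two),
    ae_restrict_mem measurableSet_Icc] with t ht htm
  exact (((ht.const_add (greenDerivC F (0, 0))).congr_of_mem hprim htm).derivWithin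
    (uniqueDiffOn_Icc hT t htm))

theorem isL2Primitive_D_recon (hF : IsL2Primitive T (fun x t => F (x, t)) a b h) (hT : 0 < T) :
    IsL2Primitive T (D T 2 2 (recon F)) a b h :=
  hF.congr hT.le (D_recon hT F le_rfl le_rfl)

theorem D_recon_initial (hT : 0 < T) {i j : ℕ} (hi : i ≤ 2) (hj : j < 2) {x : ℝ}
    (hx : x ∈ Icc (0 : ℝ) 1) : D T i j (recon F) x 0 = 0 := by
  induction i generalizing x with
  | zero =>
    rw [D_recon hT F zero_le_two hj.le x hx 0 (left_mem_Icc.2 hT.le)]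
    interval_cases j
    exacts [((isDerivFamily_recon T F).initial x hx).1, ((isDerivFamily_recon T F).initial x hx).2]
  | succ i ih =>
    rw [D_succ_left, dx, derivWithin_congr (f := fun _ => (0 : ℝ)) (fun y hy => ih (by omega) hy)
      (ih (by omega) hx)]
    simp

theorem dx_D_recon_initial (hT : 0 < T) {j : ℕ} (hj : j < 2) {x : ℝ}
    (hx : x ∈ Icc (0 : ℝ) 1) : dx (D T 2 j (recon F)) x 0 = 0 := by
  rw [dx, derivWithin_congr (f := fun _ => (0 : ℝ)) (fun y hy => D_recon_initial hT le_rfl hj hy)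
    (D_recon_initial hT le_rfl hj hx)]
  simp

theorem memW_recon (hF : IsL2Primitive T (fun x t => F (x, t)) a b h) (hT : 0 < T) :
    MemW T (recon F) := by
  have hfam := isDerivFamily_recon T F
  have hD := fun {i j : ℕ} (hi : i ≤ 2) (hj : j ≤ 2) => D_recon hT F hi hj
  have hH := (isL2Primitive_D_recon hF hT).memHatW hT
  refine ⟨fun j hj x hx t ht => ?_, fun i hi j hj x hx t ht => ?_, hH.completelyContinuous,
    hH.memLp_top, fun i hi => ?_, fun j hj => ?_, fun x hx => ?_, hfam.boundary⟩
  · exact ((hfam.deriv_t j hj x hx t ht).congr_of_mem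
      (fun s hs => hD zero_le_two hj.le x hx s hs) ht).differentiableWithinAt
  · exact ((hfam.deriv_x i hi j hj x hx t ht).congr_of_mem
      (fun y hy => hD hi.le hj y hy t ht) hx).differentiableWithinAt
  · interval_cases i
    · refine (memLp_congr_ae ?_).2 (memLp_const (0 : ℝ))
      filter_upwards [ae_restrict_mem measurableSet_Icc] with t ht using dt_recon_zero hT ht
    · exact (memLp_congr_ae (ae_dt_recon_one hF hT)).2 hF.memLp_slopeData
    · exact hH.memLp_left
  · rw [iteratedDerivWithin_three]
    rcases hj.lt_or_eq with hj | rfl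
    · refine (memLp_congr_ae ?_).2 (memLp_const (0 : ℝ))
      filter_upwards [ae_restrict_mem measurableSet_Icc] with x hx using dx_D_recon_initial hT hj hx
    · exact hH.memLp_bottom
  · exact ⟨D_recon_initial (i := 0) hT zero_le_two zero_lt_two hx,
      D_recon_initial (i := 0) hT zero_le_two one_lt_two hx⟩

theorem inner3_recon_of_lt_two (hT : 0 < T) {j : ℕ} (hj : j < 2) (w : ℝ → ℝ) :
    inner3 (fun x => D T 0 j (recon F) x 0) w = 0 := by
  have hderiv : ∀ x ∈ Icc (0 : ℝ) 1,
      derivWithin (fun x => D T 0 j (recon F) x 0) (Icc 0 1) x = 0 :=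
    fun x hx => D_recon_initial (i := 1) hT one_le_two hj hx
  have hthird : ∫ x in (0 : ℝ)..1, dx (D T 2 j (recon F)) x 0 *
      iteratedDerivWithin 3 w (Icc 0 1) x = 0 := by
    refine (intervalIntegral.integral_congr fun x hx => ?_).trans intervalIntegral.integral_zero
    rw [uIcc_of_le zero_le_one] at hx
    simp only [dx_D_recon_initial hT hj hx, zero_mul]
  rw [inner3, iteratedDerivWithin_three, hthird, hderiv 0 (left_mem_Icc.2 zero_le_one),
    hderiv 1 (right_mem_Icc.2 zero_le_one),
    D_recon_initial hT zero_le_two hj (left_mem_Icc.2 zero_le_one)]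
  ring

variable {F' : C(ℝ × ℝ, ℝ)} {a' b' : ℝ → ℝ} {h' : ℝ → ℝ → ℝ}

theorem inner3_recon_two (hF : IsL2Primitive T (fun x t => F (x, t)) a b h)
    (hF' : IsL2Primitive T (fun x t => F' (x, t)) a' b' h') (hT : 0 < T) :
    inner3 (fun x => D T 0 2 (recon F) x 0) (fun x => D T 0 2 (recon F') x 0) =
      greenDerivC F (0, 0) * greenDerivC F' (0, 0) + greenDerivC F (1, 0) * greenDerivC F' (1, 0)
        + ∫ x, a x * a' x ∂leb 1 := by
  have h0 : (0 : ℝ) ∈ Icc 0 T := left_mem_Icc.2 hT.le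
  have hderiv : ∀ (F : C(ℝ × ℝ, ℝ)), ∀ x ∈ Icc (0 : ℝ) 1,
      derivWithin (fun x => D T 0 2 (recon F) x 0) (Icc 0 1) x = greenDerivC F (x, 0) :=
    fun F x hx => D_recon hT F (i := 1) one_le_two le_rfl x hx 0 h0
  have hvalue : D T 0 2 (recon F) 0 0 = 0 :=
    (D_recon hT F zero_le_two le_rfl 0 (left_mem_Icc.2 zero_le_one) 0 h0).trans (greenC_zero F 0)
  rw [inner3, iteratedDerivWithin_three, iteratedDerivWithin_three, hvalue,
    intervalIntegral_mul_eq_of_ae zero_le_one ((isL2Primitive_D_recon hF hT).ae_dx_bottom hT.le)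
      ((isL2Primitive_D_recon hF' hT).ae_dx_bottom hT.le)]
  simp only [hderiv _ 0 (left_mem_Icc.2 zero_le_one), hderiv _ 1 (right_mem_Icc.2 zero_le_one)]
  ring

theorem innerW_recon (hF : IsL2Primitive T (fun x t => F (x, t)) a b h)
    (hF' : IsL2Primitive T (fun x t => F' (x, t)) a' b' h') (hT : 0 < T) :
    innerW T (recon F) (recon F') =
      (∫ t, slopeData b h t * slopeData b' h' t ∂leb T) + (∫ t, b t * b' t ∂leb T)
      + (greenDerivC F (0, 0) * greenDerivC F' (0, 0) + greenDerivC F (1, 0) * greenDerivC F' (1, 0)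
        + ∫ x, a x * a' x ∂leb 1) + ∫ q, h q.1 q.2 * h' q.1 q.2 ∂((leb 1).prod (leb T)) := by
  have hD := isL2Primitive_D_recon hF hT
  have hD' := isL2Primitive_D_recon hF' hT
  have hzero : ∫ t in (0 : ℝ)..T, dt T (D T 0 2 (recon F)) 0 t * dt T (D T 0 2 (recon F')) 0 t
      = 0 := by
    refine (intervalIntegral.integral_congr fun t ht => ?_).trans intervalIntegral.integral_zero
    rw [uIcc_of_le hT.le] at ht
    simp only [dt_recon_zero hT ht, zero_mul]
  simp only [innerW, Finset.sum_range_succ, Finset.sum_range_zero]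
  rw [hzero, inner3_recon_two hF hF' hT, inner3_recon_of_lt_two hT zero_lt_two,
    inner3_recon_of_lt_two hT one_lt_two,
    intervalIntegral_mul_eq_of_ae hT.le (ae_dt_recon_one hF hT) (ae_dt_recon_one hF' hT),
    intervalIntegral_mul_eq_of_ae hT.le (hD.ae_dt_left hT) (hD'.ae_dt_left hT),
    iteratedIntegral_mul_eq_of_ae hT.le (hD.ae_dx_dt hT) (hD'.ae_dx_dt hT) hD.h_memLp hD'.h_memLp]
  ring

end Recon

/-! ### The space `W(Ω)` as a Hilbert space -/

section SetIntegral

variable {α : Type*} [MeasurableSpace α] {μ : Measure α} [IsFiniteMeasure μ] {s : Set α}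

/-- Integration over a set, as a continuous linear functional on `L²`. -/
noncomputable def setIntegralL2 (hs : MeasurableSet s) : Lp ℝ 2 μ →L[ℝ] ℝ :=
  innerSL ℝ (indicatorConstLp 2 hs (measure_ne_top μ s) (1 : ℝ))

theorem setIntegralL2_apply (hs : MeasurableSet s) (f : Lp ℝ 2 μ) :
    setIntegralL2 hs f = ∫ x in s, f x ∂μ :=
  L2.inner_indicatorConstLp_one hs (measure_ne_top μ s) f

theorem setIntegralL2_toLp (hs : MeasurableSet s) {f : α → ℝ} (hf : MemLp f 2 μ) :
    setIntegralL2 hs (hf.toLp f) = ∫ x in s, f x ∂μ := by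
  rw [setIntegralL2_apply]
  exact integral_congr_ae (ae_restrict_of_ae hf.coeFn_toLp)

theorem abs_setIntegralL2_le (hs : MeasurableSet s) (f : Lp ℝ 2 μ) :
    |setIntegralL2 hs f| ≤ √(μ.real univ) * ‖f‖ := by
  refine (norm_inner_le_norm (𝕜 := ℝ) _ _).trans (mul_le_mul_of_nonneg_right ?_ (norm_nonneg f))
  refine (norm_indicatorConstLp_le (p := 2)).trans ?_
  rw [norm_one, one_mul, ENNReal.toReal_ofNat, ← Real.sqrt_eq_rpow]
  exact Real.sqrt_le_sqrt (measureReal_mono (subset_univ s))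

end SetIntegral

theorem setIntegral_Ioc_leb {l x : ℝ} (hx : x ∈ Icc 0 l) (f : ℝ → ℝ) :
    ∫ ξ in Ioc 0 x, f ξ ∂leb l = ∫ ξ in (0 : ℝ)..x, f ξ := by
  rw [Measure.restrict_restrict measurableSet_Ioc,
    inter_eq_left.2 (Ioc_subset_Icc_self.trans (Icc_subset_Icc_right hx.2)),
    intervalIntegral.integral_of_le hx.1]

theorem setIntegral_Ioc_prod_Ioc {T x t : ℝ} {h : ℝ → ℝ → ℝ}
    (hh : Integrable (fun q : ℝ × ℝ => h q.1 q.2) ((leb 1).prod (leb T)))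
    (hx : x ∈ Icc (0 : ℝ) 1) (ht : t ∈ Icc (0 : ℝ) T) :
    ∫ q in Ioc 0 x ×ˢ Ioc 0 t, h q.1 q.2 ∂((leb 1).prod (leb T)) =
      ∫ ξ in (0 : ℝ)..x, ∫ τ in (0 : ℝ)..t, h ξ τ := by
  rw [setIntegral_prod _ hh.integrableOn]
  simp only [setIntegral_Ioc_leb ht, setIntegral_Ioc_leb hx]

/-- The data `f(0,0)`, `∂f/∂x(·,0)`, `∂f/∂t(0,·)`, `∂²f/∂x∂t` of a function `f ∈ Ŵ(Ω)`. Applied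
to `f = ∂⁴u/∂x²∂t²`, they parametrize the functions `u ∈ W(Ω)`. -/
abbrev Data (T : ℝ) : Type :=
  ℝ × Lp ℝ 2 (leb 1) × Lp ℝ 2 (leb T) × Lp ℝ 2 ((leb 1).prod (leb T))

namespace Data

variable {T : ℝ}

/-- The component `f(0,0)` of the data. -/
noncomputable def corner : Data T →L[ℝ] ℝ := .fst ℝ _ _

/-- The component `∂f/∂x(·,0)` of the data. -/
noncomputable def bottom : Data T →L[ℝ] Lp ℝ 2 (leb 1) := .fst ℝ _ _ ∘L .snd ℝ _ _

/-- The component `∂f/∂t(0,·)` of the data. -/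
noncomputable def left : Data T →L[ℝ] Lp ℝ 2 (leb T) := .fst ℝ _ _ ∘L .snd ℝ _ _ ∘L .snd ℝ _ _

/-- The component `∂²f/∂x∂t` of the data. -/
noncomputable def mixed : Data T →L[ℝ] Lp ℝ 2 ((leb 1).prod (leb T)) :=
  .snd ℝ _ _ ∘L .snd ℝ _ _ ∘L .snd ℝ _ _

theorem norm_eq (d : Data T) :
    ‖d‖ = max ‖corner d‖ (max ‖bottom d‖ (max ‖left d‖ ‖mixed d‖)) := rfl

/-- The value at `(x, t)` of the double primitive of the data. -/
noncomputable def val (T x t : ℝ) : Data T →L[ℝ] ℝ :=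
  corner + setIntegralL2 (measurableSet_Ioc (a := 0) (b := x)) ∘L bottom +
    setIntegralL2 (measurableSet_Ioc (a := 0) (b := t)) ∘L left +
    setIntegralL2 ((measurableSet_Ioc (a := 0) (b := x)).prod
      (measurableSet_Ioc (a := 0) (b := t))) ∘L mixed

theorem val_apply {x t : ℝ} (hx : x ∈ Icc (0 : ℝ) 1) (ht : t ∈ Icc (0 : ℝ) T) (d : Data T) :
    val T x t d = corner d + (∫ ξ in (0 : ℝ)..x, bottom d ξ) + (∫ τ in (0 : ℝ)..t, left d τ)
      + ∫ ξ in (0 : ℝ)..x, ∫ τ in (0 : ℝ)..t, mixed d (ξ, τ) := by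
  simp only [val, add_apply, ContinuousLinearMap.comp_apply, setIntegralL2_apply,
    setIntegral_Ioc_leb hx, setIntegral_Ioc_leb ht]
  rw [← setIntegral_Ioc_prod_Ioc ((Lp.memLp (mixed d)).integrable one_le_two) hx ht]

theorem exists_abs_val_le (T : ℝ) : ∃ C, 0 ≤ C ∧ ∀ x t (d : Data T), |val T x t d| ≤ C * ‖d‖ := by
  refine ⟨1 + √((leb 1).real univ) + √((leb T).real univ) +
    √(((leb 1).prod (leb T)).real univ), by positivity, fun x t d => ?_⟩
  rw [add_mul, add_mul, add_mul, one_mul]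
  refine (abs_add_le _ _).trans (add_le_add ((abs_add_le _ _).trans (add_le_add
    ((abs_add_le _ _).trans (add_le_add ?_ ?_)) ?_)) ?_)
  · exact norm_fst_le d
  · exact (abs_setIntegralL2_le _ _).trans (by rw [norm_eq]; gcongr; simp)
  · exact (abs_setIntegralL2_le _ _).trans (by rw [norm_eq]; gcongr; simp)
  · exact (abs_setIntegralL2_le _ _).trans (by rw [norm_eq]; gcongr; simp)

theorem isL2Primitive_val (hT : 0 ≤ T) (d : Data T) :
    IsL2Primitive T (fun x t => val T x t d) (bottom d) (left d) (fun x t => mixed d (x, t)) where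
  a_memLp := Lp.memLp _
  b_memLp := Lp.memLp _
  h_memLp := Lp.memLp _
  prim x hx t ht := by
    beta_reduce
    rw [val_apply hx ht, val_apply (left_mem_Icc.2 zero_le_one) (left_mem_Icc.2 hT)]
    simp

/-- The double primitive of the data, as a continuous function on the compact rectangle. -/
noncomputable def primOn (hT : 0 ≤ T) : Data T →L[ℝ] C(I × Icc 0 T, ℝ) :=
  LinearMap.mkContinuousOfExistsBound
    { toFun := fun d => ⟨fun q => val T q.1 q.2 d,
        ((isL2Primitive_val hT d).continuousOn hT).comp_continuous
          (f := fun q : I × Icc 0 T => ((q.1 : ℝ), (q.2 : ℝ))) (by fun_prop)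
          fun q => ⟨q.1.2, q.2.2⟩⟩
      map_add' := fun d e => ContinuousMap.ext fun q => (val T q.1 q.2).map_add d e
      map_smul' := fun c d => ContinuousMap.ext fun q => (val T q.1 q.2).map_smul c d } <| by
    obtain ⟨C, hC, hval⟩ := exists_abs_val_le T
    exact ⟨C, fun d => (ContinuousMap.norm_le _ (by positivity)).2 fun q => hval q.1 q.2 d⟩

/-- The double primitive of the data, extended continuously to the plane. -/
noncomputable def prim (hT : 0 ≤ T) : Data T →L[ℝ] C(ℝ × ℝ, ℝ) :=
  ContinuousMap.compCLM ℝ ℝ ⟨fun q : ℝ × ℝ => (projIcc 0 1 zero_le_one q.1, projIcc 0 T hT q.2),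
    by fun_prop⟩ ∘L primOn hT

theorem prim_apply (hT : 0 ≤ T) (d : Data T) {x t : ℝ} (hx : x ∈ Icc (0 : ℝ) 1)
    (ht : t ∈ Icc (0 : ℝ) T) : prim hT d (x, t) = val T x t d := by
  change val T (projIcc 0 1 zero_le_one x) (projIcc 0 T hT t) d = _
  rw [projIcc_of_mem _ hx, projIcc_of_mem _ ht]

theorem isL2Primitive_prim (hT : 0 ≤ T) (d : Data T) : IsL2Primitive T (fun x t => prim hT d (x, t))
    (bottom d) (left d) (fun x t => mixed d (x, t)) :=
  (isL2Primitive_val hT d).congr hT fun _ hx _ ht => prim_apply hT d hx ht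

/-- The function `u ∈ W(Ω)` with the given data for `∂⁴u/∂x²∂t²`, as a continuous function. -/
noncomputable def toC (hT : 0 ≤ T) : Data T →L[ℝ] C(ℝ × ℝ, ℝ) :=
  greenC ∘L primTC ∘L primTC ∘L prim hT

/-- The function `u ∈ W(Ω)` with the given data for `∂⁴u/∂x²∂t²`. -/
noncomputable def toFun (hT : 0 ≤ T) (d : Data T) : ℝ → ℝ → ℝ := fun x t => toC hT d (x, t)

theorem memW_toFun (hT : 0 < T) (d : Data T) : MemW T (d.toFun hT.le) :=
  memW_recon (isL2Primitive_prim hT.le d) hT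

/-- `L u` for the function `u ∈ W(Ω)` with the given data. -/
noncomputable def waveC (hT : 0 ≤ T) : Data T →L[ℝ] C(ℝ × ℝ, ℝ) :=
  greenC ∘L prim hT - primTC ∘L primTC ∘L prim hT

theorem waveC_apply (hT : 0 < T) (d : Data T) {x t : ℝ} (hx : x ∈ Icc (0 : ℝ) 1)
    (ht : t ∈ Icc (0 : ℝ) T) : waveC hT.le d (x, t) = waveOp T (d.toFun hT.le) x t :=
  (waveOp_recon hT _ x hx t ht).symm

end Data

theorem MemHatW.exists_data {T : ℝ} (hT : 0 < T) {f : ℝ → ℝ → ℝ} (hf : MemHatW T f) :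
    ∃ d : Data T, EqOmega T f fun x t => Data.prim hT.le d (x, t) := by
  obtain ⟨a, b, h, hf⟩ := hf.exists_isL2Primitive hT
  refine ⟨(f 0 0, hf.a_memLp.toLp _, hf.b_memLp.toLp _, hf.h_memLp.toLp _), fun x hx t ht => ?_⟩
  beta_reduce
  rw [Data.prim_apply hT.le _ hx ht, hf.prim x hx t ht,
    ← setIntegral_Ioc_prod_Ioc (hf.h_memLp.integrable one_le_two) hx ht, ← setIntegral_Ioc_leb hx,
    ← setIntegral_Ioc_leb ht, ← setIntegralL2_toLp _ hf.a_memLp, ← setIntegralL2_toLp _ hf.b_memLp,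
    ← setIntegralL2_toLp _ hf.h_memLp]
  rfl

theorem IsDerivFamily.exists_data {T : ℝ} {u : ℕ → ℕ → ℝ → ℝ → ℝ} (hu : IsDerivFamily T u)
    (hT : 0 < T) (h : MemHatW T (u 2 2)) : ∃ d : Data T, EqOmega T (u 0 0) (d.toFun hT.le) := by
  obtain ⟨d, hd⟩ := h.exists_data hT
  exact ⟨d, hu.eq_recon hT hd⟩

theorem MemW.exists_data {T : ℝ} {u : ℝ → ℝ → ℝ} (hu : MemW T u) (hT : 0 < T) :
    ∃ d : Data T, EqOmega T u (d.toFun hT.le) :=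
  hu.isDerivFamily.exists_data hT hu.memHatW

section Hilbert

variable {E F G : Type*} [NormedAddCommGroup E] [NormedSpace ℝ E]
  [NormedAddCommGroup F] [InnerProductSpace ℝ F] [NormedAddCommGroup G] [InnerProductSpace ℝ G]

/-- The map into the Hilbert sum with the components `f` and `g`. -/
noncomputable def l2prod (f : E →L[ℝ] F) (g : E →L[ℝ] G) : E →L[ℝ] WithLp 2 (F × G) :=
  (WithLp.prodContinuousLinearEquiv 2 ℝ F G).symm.toContinuousLinearMap ∘L f.prod g

theorem inner_l2prod (f : E →L[ℝ] F) (g : E →L[ℝ] G) (x y : E) :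
    ⟪l2prod f g x, l2prod f g y⟫_ℝ = ⟪f x, f y⟫_ℝ + ⟪g x, g y⟫_ℝ := rfl

theorem norm_fst_le_norm_l2prod (f : E →L[ℝ] F) (g : E →L[ℝ] G) (x : E) :
    ‖f x‖ ≤ ‖l2prod f g x‖ :=
  WithLp.norm_fst_le _ (l2prod f g x)

theorem norm_snd_le_norm_l2prod (f : E →L[ℝ] F) (g : E →L[ℝ] G) (x : E) :
    ‖g x‖ ≤ ‖l2prod f g x‖ :=
  WithLp.norm_snd_le _ (l2prod f g x)

theorem exists_forall_inner_map_eq [CompleteSpace E] [CompleteSpace F] (J : E →L[ℝ] F) {C : NNReal}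
    (hJ : AntilipschitzWith C J) (l : E →L[ℝ] ℝ) : ∃ e, ∀ d, ⟪J d, J e⟫_ℝ = l d := by
  have hclosed : IsClosed (range J) := hJ.isClosed_range J.uniformContinuous
  have : CompleteSpace J.range := hclosed.completeSpace_coe
  let J' := J.equivRange hJ.injective hclosed
  let k := (InnerProductSpace.toDual ℝ J.range).symm (l ∘L J'.symm.toContinuousLinearMap)
  have hk : ∀ d, ⟪k, J' d⟫_ℝ = l d := fun d => by
    rw [InnerProductSpace.toDual_symm_apply]
    simp
  refine ⟨J'.symm k, fun d => ?_⟩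
  rw [real_inner_comm, ← hk d]
  exact congrArg (fun z : J.range => ⟪(z : F), J d⟫_ℝ) (J'.apply_symm_apply k)

end Hilbert

namespace Data

variable {T : ℝ}

/-- The derivative in `t` of `∂³u/∂x∂t²(0,t)` as an element of `L²`. -/
noncomputable def slope (T : ℝ) : Data T →L[ℝ] Lp ℝ 2 (leb T) :=
  -((2⁻¹ : ℝ) • left + partialIntegral memLp_slopeWeight ∘L mixed)

theorem coeFn_slope (d : Data T) :
    ∀ᵐ t ∂leb T, slope T d t = slopeData (left d) (fun x t => mixed d (x, t)) t := by
  filter_upwards [Lp.coeFn_neg ((2⁻¹ : ℝ) • left d + partialIntegral memLp_slopeWeight (mixed d)),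
    Lp.coeFn_add ((2⁻¹ : ℝ) • left d) (partialIntegral memLp_slopeWeight (mixed d)),
    Lp.coeFn_smul (2⁻¹ : ℝ) (left d), coeFn_partialIntegral memLp_slopeWeight (mixed d)]
    with t hneg hadd hsmul hpartial
  refine hneg.trans ?_
  rw [Pi.neg_apply, hadd, Pi.add_apply, hsmul, hpartial, Pi.smul_apply, smul_eq_mul, slopeData,
    inv_mul_eq_div]

theorem inner_slope (d e : Data T) : ⟪slope T d, slope T e⟫_ℝ =
    ∫ t, slopeData (left d) (fun x t => mixed d (x, t)) t *
      slopeData (left e) (fun x t => mixed e (x, t)) t ∂leb T := by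
  rw [inner_Lp_eq]
  refine integral_congr_ae ?_
  filter_upwards [coeFn_slope d, coeFn_slope e] with t hd he
  rw [hd, he]

/-- The value of `∂³u/∂x∂t²(x,0)`. -/
noncomputable def boundarySlope (hT : 0 ≤ T) (x : ℝ) : Data T →L[ℝ] ℝ :=
  ContinuousMap.evalCLM ℝ (x, (0 : ℝ)) ∘L greenDerivC ∘L prim hT

/-- The Hilbert space of the terms of the inner product of `W(Ω)` that do not vanish by the initial
and boundary conditions. -/
abbrev Target (T : ℝ) : Type :=
  WithLp 2 (Lp ℝ 2 (leb T) × WithLp 2 (Lp ℝ 2 (leb T) × WithLp 2 (ℝ × WithLp 2 (ℝ ×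
    WithLp 2 (Lp ℝ 2 (leb 1) × Lp ℝ 2 ((leb 1).prod (leb T)))))))

/-- The isometric embedding of `W(Ω)` into `Target T`, in terms of the data. -/
noncomputable def embed (hT : 0 ≤ T) : Data T →L[ℝ] Target T :=
  l2prod (slope T) (l2prod left (l2prod (boundarySlope hT 0) (l2prod (boundarySlope hT 1)
    (l2prod bottom mixed))))

theorem inner_embed (hT : 0 < T) (d e : Data T) :
    ⟪embed hT.le d, embed hT.le e⟫_ℝ = innerW T (d.toFun hT.le) (e.toFun hT.le) := by
  have hreal : ∀ x, ⟪boundarySlope hT.le x d, boundarySlope hT.le x e⟫_ℝ =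
      greenDerivC (prim hT.le d) (x, 0) * greenDerivC (prim hT.le e) (x, 0) :=
    fun x => mul_comm _ _
  refine Eq.trans ?_
    (innerW_recon (isL2Primitive_prim hT.le d) (isL2Primitive_prim hT.le e) hT).symm
  rw [embed, inner_l2prod, inner_l2prod, inner_l2prod, inner_l2prod, inner_l2prod, inner_slope,
    hreal, hreal, inner_Lp_eq, inner_Lp_eq, inner_Lp_eq]
  ring

theorem norm_component_le_embed (hT : 0 ≤ T) (d : Data T) :
    ‖left d‖ ≤ ‖embed hT d‖ ∧ ‖boundarySlope hT 0 d‖ ≤ ‖embed hT d‖ ∧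
      ‖boundarySlope hT 1 d‖ ≤ ‖embed hT d‖ ∧ ‖bottom d‖ ≤ ‖embed hT d‖ ∧
      ‖mixed d‖ ≤ ‖embed hT d‖ := by
  have h₁ : _ ≤ ‖embed hT d‖ := norm_snd_le_norm_l2prod _ _ d
  have h₂ := (norm_snd_le_norm_l2prod _ _ d).trans h₁
  have h₃ := (norm_snd_le_norm_l2prod _ _ d).trans h₂
  have h₄ := (norm_snd_le_norm_l2prod _ _ d).trans h₃
  exact ⟨(norm_fst_le_norm_l2prod _ _ d).trans h₁, (norm_fst_le_norm_l2prod _ _ d).trans h₂,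
    (norm_fst_le_norm_l2prod _ _ d).trans h₃, (norm_fst_le_norm_l2prod _ _ d).trans h₄,
    (norm_snd_le_norm_l2prod _ _ d).trans h₄⟩

theorem abs_prim_bottom_sub_corner_le (hT : 0 ≤ T) (d : Data T) {x : ℝ} (hx : x ∈ Icc (0 : ℝ) 1) :
    |prim hT d (x, 0) - corner d| ≤ ‖bottom d‖ := by
  have hval := abs_setIntegralL2_le (measurableSet_Ioc (a := 0) (b := x)) (bottom d)
  rw [setIntegralL2_apply, setIntegral_Ioc_leb hx] at hval
  rw [prim_apply hT d hx (left_mem_Icc.2 hT), val_apply hx (left_mem_Icc.2 hT)]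
  simpa [measureReal_def] using hval

theorem boundarySlope_one_sub_zero (hT : 0 ≤ T) (d : Data T) :
    boundarySlope hT 1 d - boundarySlope hT 0 d = ∫ x in (0 : ℝ)..1, prim hT d (x, 0) := by
  change greenDerivC (prim hT d) (1, 0) - greenDerivC (prim hT d) (0, 0) = _
  simp [greenDerivC_apply, primXC_apply]

theorem norm_corner_le (hT : 0 ≤ T) (d : Data T) :
    ‖corner d‖ ≤ ‖boundarySlope hT 1 d‖ + ‖boundarySlope hT 0 d‖ + ‖bottom d‖ := by
  have hdiff : ‖∫ x in (0 : ℝ)..1, (prim hT d (x, 0) - corner d)‖ ≤ ‖bottom d‖ := by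
    refine (intervalIntegral.norm_integral_le_of_norm_le_const fun x hx => ?_).trans_eq
      (by rw [sub_zero, abs_one, mul_one])
    rw [uIoc_of_le zero_le_one] at hx
    exact abs_prim_bottom_sub_corner_le hT d (Ioc_subset_Icc_self hx)
  rw [intervalIntegral.integral_sub ((continuous_curry_left _ 0).intervalIntegrable _ _)
    intervalIntegrable_const, ← boundarySlope_one_sub_zero, intervalIntegral.integral_const,
    sub_zero, one_smul] at hdiff
  calc ‖corner d‖ = ‖(boundarySlope hT 1 d - boundarySlope hT 0 d) -
        (boundarySlope hT 1 d - boundarySlope hT 0 d - corner d)‖ := by rw [sub_sub_cancel]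
    _ ≤ _ := (norm_sub_le _ _).trans (add_le_add (norm_sub_le _ _) hdiff)

theorem norm_le_three_mul_norm_embed (hT : 0 ≤ T) (d : Data T) : ‖d‖ ≤ 3 * ‖embed hT d‖ := by
  obtain ⟨hleft, hslope₀, hslope₁, hbottom, hmixed⟩ := norm_component_le_embed hT d
  have hcorner := norm_corner_le hT d
  rw [norm_eq]
  refine max_le ?_ (max_le ?_ (max_le ?_ ?_)) <;> linarith [norm_nonneg (embed hT d)]

theorem antilipschitz_embed (hT : 0 ≤ T) : AntilipschitzWith 3 (embed (T := T) hT) :=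
  AddMonoidHomClass.antilipschitz_of_bound _ (norm_le_three_mul_norm_embed hT)

theorem exists_forall_inner_embed_eq_waveC (hT : 0 ≤ T) (q : ℝ × ℝ) :
    ∃ e : Data T, ∀ d, ⟪embed hT d, embed hT e⟫_ℝ = waveC hT d q :=
  exists_forall_inner_map_eq (embed hT) (antilipschitz_embed hT)
    (ContinuousMap.evalCLM ℝ q ∘L waveC hT)

end Data

section Congruence

variable {T : ℝ} {f f' g g' : ℝ → ℝ → ℝ}

theorem EqOmega.waveOp (h : EqOmega T f g) : EqOmega T (waveOp T f) (waveOp T g) :=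
  fun x hx t ht => congrArg₂ (· - ·) (D_congr h 0 2 x hx t ht) (D_congr h 2 0 x hx t ht)

theorem MemHatW.congr (hT : 0 < T) (hf : MemHatW T f) (h : EqOmega T g f) : MemHatW T g := by
  obtain ⟨_, _, _, hprim⟩ := hf.exists_isL2Primitive hT
  exact (hprim.congr hT.le h).memHatW hT

theorem inner3_congr {v v' w w' : ℝ → ℝ} (hv : EqOn v v' I) (hw : EqOn w w' I) :
    inner3 v w = inner3 v' w' := by
  have h0 : (0 : ℝ) ∈ I := unitInterval.zero_mem
  have h1 : (1 : ℝ) ∈ I := unitInterval.one_mem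
  unfold inner3
  rw [hv h0, hw h0, derivWithin_congr hv (hv h0), derivWithin_congr hw (hw h0),
    derivWithin_congr hv (hv h1), derivWithin_congr hw (hw h1)]
  congr 1
  refine intervalIntegral.integral_congr fun x hx => ?_
  rw [uIcc_of_le zero_le_one] at hx
  exact congrArg₂ (· * ·) (iteratedDerivWithin_congr hv hx) (iteratedDerivWithin_congr hw hx)

theorem innerW_congr (hT : 0 ≤ T) (hf : EqOmega T f f') (hg : EqOmega T g g') :
    innerW T f g = innerW T f' g' := by
  have hbottom : ∀ {f f' : ℝ → ℝ → ℝ}, EqOmega T f f' → ∀ j,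
      EqOn (fun x => D T 0 j f x 0) (fun x => D T 0 j f' x 0) I :=
    fun h j x hx => D_congr h 0 j x hx 0 (left_mem_Icc.2 hT)
  refine congrArg₂ (· + ·) (congrArg₂ (· + ·) (Finset.sum_congr rfl fun i _ =>
    intervalIntegral.integral_congr fun t ht => ?_) (Finset.sum_congr rfl fun j _ =>
    inner3_congr (hbottom hf j) (hbottom hg j))) (intervalIntegral.integral_congr fun x hx =>
    intervalIntegral.integral_congr fun t ht => ?_)
  all_goals rw [uIcc_of_le hT] at ht
  · exact congrArg₂ (· * ·) (dt_congr (D_congr hf i 2) 0 unitInterval.zero_mem t ht)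
      (dt_congr (D_congr hg i 2) 0 unitInterval.zero_mem t ht)
  · rw [uIcc_of_le zero_le_one] at hx
    exact congrArg₂ (· * ·) (dx_congr (dt_congr (D_congr hf 2 2)) x hx t ht)
      (dx_congr (dt_congr (D_congr hg 2 2)) x hx t ht)

end Congruence

theorem memHatW_waveOp {T : ℝ} (hT : 0 < T) {w : ℝ → ℝ → ℝ} (hw : MemW T w) :
    MemHatW T (waveOp T w) := by
  obtain ⟨d, hd⟩ := hw.exists_data hT
  exact (memHatW_waveOp_recon (Data.isL2Primitive_prim hT.le d) hT).congr hT hd.waveOp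

/-! ### Functions with prescribed wave operator at finitely many points -/

section TestFunctions

variable {T : ℝ}

theorem exists_contDiff_localization {n : ℕ∞} {g : ℝ → ℝ} (hg : ContDiff ℝ n g) (c : ℝ) {F : Set ℝ}
    (hF : F.Finite) :
    ∃ X : ℝ → ℝ, ContDiff ℝ n X ∧ X =ᶠ[𝓝 c] g ∧ ∀ x ∈ F, x ≠ c → X =ᶠ[𝓝 x] 0 := by
  obtain ⟨r, hr, hball⟩ := Metric.nhds_basis_closedBall.mem_iff.1
    ((hF.sdiff (t := {c})).isClosed.isOpen_compl.mem_nhds fun h => h.2 rfl)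
  let χ : ContDiffBump c := ⟨r / 2, r, half_pos hr, half_lt_self hr⟩
  refine ⟨fun x => χ x * g x, χ.contDiff.mul hg, ?_, fun x hx hxc => ?_⟩
  · filter_upwards [χ.eventuallyEq_one] with x hx
    rw [hx, Pi.one_apply, one_mul]
  · filter_upwards [notMem_tsupport_iff_eventuallyEq.1 fun h =>
      hball (χ.tsupport_eq ▸ h) ⟨hx, hxc⟩] with y hy
    rw [hy, Pi.zero_apply, zero_mul]

theorem hasDerivAt_iteratedDeriv {n : ℕ∞} {X : ℝ → ℝ} (hX : ContDiff ℝ n X) {i : ℕ} (hi : i < n)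
    (x : ℝ) : HasDerivAt (iteratedDeriv i X) (iteratedDeriv (i + 1) X x) x := by
  rw [iteratedDeriv_succ]
  exact (hX.differentiable_iteratedDeriv i (by exact_mod_cast hi) x).hasDerivAt

theorem isL2Primitive_mul {A B A' B' : ℝ → ℝ} (hA : ∀ x, HasDerivAt A (A' x) x)
    (hB : ∀ x, HasDerivAt B (B' x) x) (hA' : Continuous A') (hB' : Continuous B') :
    IsL2Primitive T (fun x t => A x * B t) (fun x => A' x * B 0) (fun t => A 0 * B' t)
      (fun x t => A' x * B' t) where
  a_memLp := memLp_of_continuous (by fun_prop)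
  b_memLp := memLp_of_continuous (by fun_prop)
  h_memLp := by
    have hA'B' : Continuous fun q : ℝ × ℝ => A' q.1 * B' q.2 := by fun_prop
    rw [memLp_two_iff_integrable_sq hA'B'.aestronglyMeasurable]
    simp only [mul_pow]
    exact (memLp_of_continuous hA').integrable_sq.mul_prod (memLp_of_continuous hB').integrable_sq
  prim x _ t _ := by
    have hftc : ∀ {A A' : ℝ → ℝ} (_ : ∀ x, HasDerivAt A (A' x) x) (_ : Continuous A') (x : ℝ),
        ∫ ξ in (0 : ℝ)..x, A' ξ = A x - A 0 := fun h hc x =>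
      intervalIntegral.integral_eq_sub_of_hasDerivAt (fun y _ => h y) (hc.intervalIntegrable _ _)
    simp only [intervalIntegral.integral_mul_const, intervalIntegral.integral_const_mul,
      hftc hA hA', hftc hB hB']
    ring

theorem exists_data_of_mul (hT : 0 < T) {X Θ : ℝ → ℝ} (hX : ContDiff ℝ 3 X)
    (hΘ : ContDiff ℝ 3 Θ) (hX0 : X 0 = 0) (hX1 : X 1 = 0) (hΘ0 : Θ 0 = 0)
    (hΘ1 : iteratedDeriv 1 Θ 0 = 0) : ∃ d : Data T, ∀ x ∈ I, ∀ t ∈ Icc (0 : ℝ) T,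
      Data.waveC hT.le d (x, t) = X x * iteratedDeriv 2 Θ t - iteratedDeriv 2 X x * Θ t := by
  have hfam : IsDerivFamily T fun i j x t => iteratedDeriv i X x * iteratedDeriv j Θ t :=
    { deriv_t := fun j hj x _ t _ => ((hasDerivAt_iteratedDeriv (n := 3) hΘ
        (by exact_mod_cast hj.trans (by norm_num)) t).const_mul _).hasDerivWithinAt
      deriv_x := fun i hi j _ x _ t _ => ((hasDerivAt_iteratedDeriv (n := 3) hX
        (by exact_mod_cast hi.trans (by norm_num)) x).mul_const _).hasDerivWithinAt
      initial := fun x _ => by simp [hΘ0, hΘ1]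
      boundary := fun t _ => by simp [hX0, hX1] }
  have hprim : IsL2Primitive T (fun x t => iteratedDeriv 2 X x * iteratedDeriv 2 Θ t) _ _ _ :=
    isL2Primitive_mul (hasDerivAt_iteratedDeriv (n := 3) hX (by norm_num))
      (hasDerivAt_iteratedDeriv (n := 3) hΘ (by norm_num)) (hX.continuous_iteratedDeriv 3 le_rfl)
      (hΘ.continuous_iteratedDeriv 3 le_rfl)
  obtain ⟨d, hd⟩ := hfam.exists_data hT (hprim.memHatW hT)
  refine ⟨d, fun x hx t ht => ?_⟩
  rw [Data.waveC_apply hT d hx ht, ← hd.waveOp x hx t ht, waveOp,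
    hfam.D_eq hT (Nat.zero_le 2) le_rfl x hx t ht, hfam.D_eq hT le_rfl (Nat.zero_le 2) x hx t ht,
    iteratedDeriv_zero, iteratedDeriv_zero]

theorem exists_data_localized (hT : 0 < T) {p : ℝ × ℝ} (hp : p ∈ Omega T) {Q : Set (ℝ × ℝ)}
    (hQ : Q.Finite) (hQΩ : Q ⊆ Omega T) (hpQ : p ∉ Q) {X Θ : ℝ → ℝ} (hX : ContDiff ℝ 3 X)
    (hΘ : ContDiff ℝ 3 Θ) (hXp : p.1 = 0 ∨ p.1 = 1 → X p.1 = 0)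
    (hΘp : p.2 = 0 → Θ p.2 = 0 ∧ iteratedDeriv 1 Θ p.2 = 0) : ∃ d : Data T,
      Data.waveC hT.le d p = X p.1 * iteratedDeriv 2 Θ p.2 - iteratedDeriv 2 X p.1 * Θ p.2 ∧
      ∀ q ∈ Q, Data.waveC hT.le d q = 0 := by
  obtain ⟨X', hX', hXX', hX'0⟩ := exists_contDiff_localization (n := 3) hX p.1
    ((hQ.image Prod.fst).union (toFinite {0, 1}))
  obtain ⟨Θ', hΘ', hΘΘ', hΘ'0⟩ := exists_contDiff_localization (n := 3) hΘ p.2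
    ((hQ.image Prod.snd).union (toFinite {0}))
  have hends : ∀ x : ℝ, x = 0 ∨ x = 1 → X' x = 0 := fun x hx => by
    by_cases hxp : x = p.1
    · rw [hxp, hXX'.eq_of_nhds, hXp (hxp ▸ hx)]
    · exact (hX'0 x (Or.inr hx) hxp).eq_of_nhds
  have hinitial : Θ' 0 = 0 ∧ iteratedDeriv 1 Θ' 0 = 0 := by
    by_cases hp0 : 0 = p.2
    · obtain ⟨h₀, h₁⟩ := hΘp hp0.symm
      rw [← hp0] at hΘΘ' h₀ h₁
      exact ⟨hΘΘ'.eq_of_nhds.trans h₀, (hΘΘ'.iteratedDeriv_eq 1).trans h₁⟩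
    · have hvanish := hΘ'0 0 (Or.inr rfl) hp0
      exact ⟨hvanish.eq_of_nhds, (hvanish.iteratedDeriv_eq 1).trans iteratedDeriv_const_zero⟩
  obtain ⟨d, hd⟩ := exists_data_of_mul hT hX' hΘ' (hends 0 (Or.inl rfl)) (hends 1 (Or.inr rfl))
    hinitial.1 hinitial.2
  refine ⟨d, ?_, fun q hq => ?_⟩
  · rw [hd p.1 hp.1 p.2 hp.2, hXX'.eq_of_nhds, hXX'.iteratedDeriv_eq, hΘΘ'.eq_of_nhds,
      hΘΘ'.iteratedDeriv_eq]
  · rw [hd q.1 (hQΩ hq).1 q.2 (hQΩ hq).2]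
    by_cases hq1 : q.1 = p.1
    · have hvanish := hΘ'0 q.2 (Or.inl (mem_image_of_mem _ hq)) fun hq2 =>
        hpQ (Prod.ext hq1 hq2 ▸ hq)
      rw [hvanish.eq_of_nhds, hvanish.iteratedDeriv_eq]
      simp
    · have hvanish := hX'0 q.1 (Or.inl (mem_image_of_mem _ hq)) hq1
      rw [hvanish.eq_of_nhds, hvanish.iteratedDeriv_eq]
      simp

theorem iteratedDeriv_half_sub_sq (c : ℝ) : iteratedDeriv 1 (fun x => (x - c) ^ 2 / 2) c = 0 ∧
    iteratedDeriv 2 (fun x => (x - c) ^ 2 / 2) c = 1 := by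
  have hderiv : deriv (fun x : ℝ => (x - c) ^ 2 / 2) = fun x => x - c := by
    ext x
    simp
  rw [iteratedDeriv_one, iteratedDeriv_succ', iteratedDeriv_one, hderiv]
  simp

theorem exists_data_separating (hT : 0 < T) {p : ℝ × ℝ} (hp : p ∈ Omega T) (hp₀ : p ≠ (0, 0))
    (hp₁ : p ≠ (1, 0)) {Q : Set (ℝ × ℝ)} (hQ : Q.Finite) (hQΩ : Q ⊆ Omega T) (hpQ : p ∉ Q) :
    ∃ d : Data T, Data.waveC hT.le d p ≠ 0 ∧ ∀ q ∈ Q, Data.waveC hT.le d q = 0 := by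
  have hsq : ∀ c : ℝ, ContDiff ℝ 3 fun x : ℝ => (x - c) ^ 2 / 2 := fun c => by fun_prop
  have hone : ContDiff ℝ 3 fun _ : ℝ => (1 : ℝ) := contDiff_const
  -- The function `(t - p₂)² / 2` works near `p`, unless `p` lies on one of the sides `x = 0` and
  -- `x = 1`, where `(x - p₁)² / 2` is compatible with the boundary conditions.
  by_cases hside : p.1 = 0 ∨ p.1 = 1
  · have hp2 : p.2 ≠ 0 := fun h => hside.elim (fun h' => hp₀ (Prod.ext h' h))
      fun h' => hp₁ (Prod.ext h' h)
    obtain ⟨d, hd, hdQ⟩ := exists_data_localized hT hp hQ hQΩ hpQ (hsq p.1) hone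
      (by simp) fun h => absurd h hp2
    refine ⟨d, ?_, hdQ⟩
    rw [hd, (iteratedDeriv_half_sub_sq _).2]
    simp [iteratedDeriv_const]
  · obtain ⟨d, hd, hdQ⟩ := exists_data_localized hT hp hQ hQΩ hpQ hone (hsq p.2)
      (fun h => absurd h hside) fun _ => ⟨by simp, (iteratedDeriv_half_sub_sq _).1⟩
    refine ⟨d, ?_, hdQ⟩
    rw [hd, (iteratedDeriv_half_sub_sq _).2]
    simp [iteratedDeriv_const]

end TestFunctions

/-! ### Orthogonal series and the Gram–Schmidt process -/

section Orthogonal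

open InnerProductSpace

variable {H : Type*} [NormedAddCommGroup H] [InnerProductSpace ℝ H]

theorem summable_of_pairwise_orthogonal [CompleteSpace H] {y : ℕ → H}
    (hy : Pairwise fun i k => ⟪y i, y k⟫_ℝ = 0) {C : ℝ}
    (hC : ∀ n, ‖∑ i ∈ Finset.range n, y i‖ ≤ C) : Summable y := by
  have hV : OrthogonalFamily ℝ (fun i => ℝ ∙ y i) fun i => (ℝ ∙ y i).subtypeₗᵢ :=
    .of_pairwise fun i k hik => Submodule.isOrtho_span.2 fun _ hu _ hv => by
      rw [mem_singleton_iff.1 hu, mem_singleton_iff.1 hv, hy hik]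
  let z : ∀ i, ℝ ∙ y i := fun i => ⟨y i, Submodule.mem_span_singleton_self _⟩
  refine (hV.summable_iff_norm_sq_summable z).2
    (summable_of_sum_range_le (c := C ^ 2) (fun _ => sq_nonneg _) fun n => ?_)
  rw [← hV.norm_sum z]
  exact pow_le_pow_left₀ (norm_nonneg _) (hC n) 2

theorem summable_of_antilipschitz {E : Type*} [NormedAddCommGroup E] [NormedSpace ℝ E]
    [CompleteSpace E] {J : E →L[ℝ] H} {K : NNReal} (hJ : AntilipschitzWith K J) {y : ℕ → E}
    (hy : Summable fun i => J (y i)) : Summable y := by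
  have hcauchy : CauchySeq fun s : Finset ℕ => ∑ i ∈ s, J (y i) := hy.hasSum.cauchySeq
  refine summable_iff_cauchySeq_finset.2
    ((hJ.isUniformInducing J.uniformContinuous).cauchy_map_iff.1 ?_)
  simpa only [map_map, Function.comp_def, map_sum] using! hcauchy

theorem eq_gramSchmidtNormed {z e : ℕ → H}
    (he : ∀ i, e i = ‖z i - ∑ k ∈ Finset.range i, ⟪z i, e k⟫_ℝ • e k‖⁻¹ •
      (z i - ∑ k ∈ Finset.range i, ⟪z i, e k⟫_ℝ • e k)) : e = gramSchmidtNormed ℝ z := by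
  funext i
  induction i using Nat.strong_induction_on with
  | _ i ih =>
    have hres : z i - ∑ k ∈ Finset.range i, ⟪z i, e k⟫_ℝ • e k = gramSchmidt ℝ z i := by
      rw [gramSchmidt_def, Nat.Iio_eq_range]
      congr 1
      refine Finset.sum_congr rfl fun k hk => ?_
      rw [ih k (Finset.mem_range.1 hk), Submodule.starProjection_singleton, gramSchmidtNormed,
        real_inner_smul_right, smul_smul, real_inner_comm]
      congr 1
      simp only [RCLike.ofReal_real_eq_id, id_eq]
      ring
    rw [he i, hres]
    rfl

theorem inner_gramSchmidtNormed_of_ne (z : ℕ → H) {i k : ℕ} (h : i ≠ k) :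
    ⟪gramSchmidtNormed ℝ z i, gramSchmidtNormed ℝ z k⟫_ℝ = 0 := by
  rw [gramSchmidtNormed, gramSchmidtNormed, real_inner_smul_left, real_inner_smul_right,
    gramSchmidt_orthogonal ℝ z h, mul_zero, mul_zero]

theorem inner_gramSchmidt_of_forall_lt {z : ℕ → H} {w : H} {i : ℕ} (hw : ∀ k < i, ⟪w, z k⟫_ℝ = 0) :
    ⟪w, gramSchmidt ℝ z i⟫_ℝ = ⟪w, z i⟫_ℝ := by
  induction i using Nat.strong_induction_on with
  | _ i ih =>
    rw [gramSchmidt_def, inner_sub_right, inner_sum, Nat.Iio_eq_range, Finset.sum_eq_zero, sub_zero]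
    intro k hk
    have hki := Finset.mem_range.1 hk
    rw [Submodule.starProjection_singleton, real_inner_smul_right,
      ih k hki fun l hl => hw l (hl.trans hki), hw k hki, mul_zero]

theorem inner_gramSchmidtNormed_ne_zero {z : ℕ → H} {w : H} {i : ℕ}
    (hw : ∀ k < i, ⟪w, z k⟫_ℝ = 0) (hwi : ⟪w, z i⟫_ℝ ≠ 0) :
    ⟪w, gramSchmidtNormed ℝ z i⟫_ℝ ≠ 0 := by
  rw [← inner_gramSchmidt_of_forall_lt hw] at hwi
  have hne : gramSchmidt ℝ z i ≠ 0 := fun h => hwi (by rw [h, inner_zero_right])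
  rw [gramSchmidtNormed, real_inner_smul_right]
  exact mul_ne_zero (inv_ne_zero (RCLike.ofReal_ne_zero.2 (norm_ne_zero_iff.2 hne))) hwi

end Orthogonal

section Recursion

theorem exists_strongRec {α : Type*} [Inhabited α] (f : ℕ → (ℕ → α) → α)
    (hf : ∀ i g g', (∀ k < i, g k = g' k) → f i g = f i g') : ∃ g : ℕ → α, ∀ i, g i = f i g := by
  let g : ℕ → α := fun n => Nat.strongRecOn (motive := fun _ => α) n
    fun n ih => f n fun k => if h : k < n then ih k h else default
  have hg : ∀ i, g i = f i fun k => if k < i then g k else default := fun i => by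
    simp only [g]
    rw [Nat.strongRecOn_eq]
    simp
  exact ⟨g, fun i => (hg i).trans (hf i _ _ fun k hk => if_pos hk)⟩

theorem exists_coeff_of_triangular {R V : Type*} [Ring R] [AddCommGroup V] [Module R V]
    {x g : ℕ → V} {c : ℕ → R} {a : ℕ → ℕ → R}
    (hg : ∀ i, g i = c i • (x i - ∑ k ∈ Finset.range i, a i k • g k)) :
    ∃ β : ℕ → ℕ → R, ∀ i, g i = ∑ k ∈ Finset.range (i + 1), β i k • x k := by
  have hspan : ∀ i, g i ∈ Submodule.span R (x '' (Finset.range (i + 1) : Set ℕ)) := by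
    intro i
    induction i using Nat.strong_induction_on with
    | _ i ih =>
      rw [hg i]
      refine Submodule.smul_mem _ _ (Submodule.sub_mem _ (Submodule.subset_span ⟨i, by simp, rfl⟩)
        (Submodule.sum_mem _ fun k hk => Submodule.smul_mem _ _ ?_))
      have hki := Finset.mem_range.1 hk
      refine Submodule.span_mono (image_mono ?_) (ih k hki)
      exact_mod_cast Finset.range_subset_range.2 (by lia)
  choose b hb using fun i => (Submodule.mem_span_image_finset_iff_exists_fun R).1 (hspan i)
  refine ⟨fun i k => if h : k ∈ Finset.range (i + 1) then b i ⟨k, h⟩ else 0, fun i => ?_⟩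
  rw [← hb i, ← Finset.sum_coe_sort (Finset.range (i + 1))]
  exact Finset.sum_congr rfl fun k _ => by simp only [dif_pos k.2]

end Recursion

theorem mapClusterPt_of_dense {T : ℝ} (hT : 0 < T) {p : ℕ → ℝ × ℝ}
    (hdense : Omega T ⊆ closure (range p)) {q : ℝ × ℝ} (hq : q ∈ Omega T) :
    MapClusterPt q atTop p := by
  rw [mapClusterPt_atTop_iff_forall_mem_closure]
  intro N
  have hfin : (p '' Iio N).Finite := (finite_Iio N).image p
  have hrange : closure (range p) = p '' Iio N ∪ closure (p '' Ici N) := by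
    rw [← image_univ, ← Iio_union_Ici (a := N), image_union, closure_union,
      hfin.isClosed.closure_eq]
  have hint : interior (Omega T) ⊆ closure (p '' Ici N) := by
    refine ((hfin.countable.dense_compl ℝ).open_subset_closure_inter isOpen_interior).trans
      (closure_minimal (fun z hz => ?_) isClosed_closure)
    exact (hrange ▸ hdense (interior_subset hz.1)).resolve_left hz.2
  have hcl : closure (interior (Omega T)) = Omega T := by
    rw [Omega, interior_prod_eq, closure_prod_eq, interior_Icc, interior_Icc,
      closure_Ioo zero_ne_one, closure_Ioo hT.ne]
  exact closure_minimal hint isClosed_closure (hcl.symm ▸ hq)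

/-! ### The iterative scheme -/

variable {T : ℝ} {M : ℝ → ℝ → ℝ → ℝ} {p : ℕ → ℝ × ℝ}

theorem IsAdjointImage.innerW_eq (hT : 0 < T) {q : ℝ × ℝ} (hq : q ∈ Omega T)
    {Ψ v : ℝ → ℝ → ℝ} (h : IsAdjointImage T (kernelG q) Ψ) (hv : MemW T v) :
    innerW T v Ψ = waveOp T v q.1 q.2 := by
  rw [h.2 v hv, innerHatW_kernelG hT (memHatW_waveOp hT hv) hq]

theorem exists_isAdjointImage (hT : 0 < T) {q : ℝ × ℝ} (hq : q ∈ Omega T) :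
    ∃ Ψ, IsAdjointImage T (kernelG q) Ψ := by
  obtain ⟨e, he⟩ := Data.exists_forall_inner_embed_eq_waveC hT.le q
  refine ⟨e.toFun hT.le, Data.memW_toFun hT e, fun v hv => ?_⟩
  obtain ⟨d, hd⟩ := hv.exists_data hT
  rw [innerHatW_kernelG hT (memHatW_waveOp hT hv) hq, hd.waveOp q.1 hq.1 q.2 hq.2,
    ← Data.waveC_apply hT d hq.1 hq.2, innerW_congr hT.le hd (.refl _), ← Data.inner_embed hT, he]

theorem residual_congr {Ψ g g' : ℕ → ℝ → ℝ → ℝ} {i : ℕ} (h : ∀ k < i, g k = g' k) :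
    residual T Ψ g i = residual T Ψ g' i := by
  unfold residual
  congr 1
  exact Finset.sum_congr rfl fun k hk => by rw [h k (Finset.mem_range.1 hk)]

theorem nonempty_scheme (hT : 0 < T) (M : ℝ → ℝ → ℝ → ℝ) (hp : ∀ i, p i ∈ Omega T) :
    Nonempty (Scheme T M p) := by
  choose Ψ hΨ using fun i => exists_isAdjointImage hT (hp i)
  obtain ⟨Ψhat, hΨhat⟩ := exists_strongRec
    (fun i g => (normW T (residual T Ψ g i))⁻¹ • residual T Ψ g i)
    fun i g g' h => by rw [residual_congr h]
  obtain ⟨β, hβ⟩ := exists_coeff_of_triangular hΨhat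
  obtain ⟨B, hB⟩ := exists_strongRec
    (fun i g => ∑ k ∈ Finset.range (i + 1),
      β i k * M (p k).1 (p k).2 ((∑ l ∈ Finset.range k, g l • Ψhat l) (p k).1 (p k).2))
    fun i g g' h => Finset.sum_congr rfl fun k hk => by
      rw [Finset.sum_congr rfl fun l hl => by
        rw [h l ((Finset.mem_range.1 hl).trans_le (Finset.mem_range_succ_iff.1 hk))]]
  exact ⟨{
    Ψ, Ψhat, β, B
    u := fun n => ∑ i ∈ Finset.range n, B i • Ψhat i
    adjoint_eq := hΨ
    gramSchmidt_eq := hΨhat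
    coeff_eq := fun i x _ t _ => by
      simpa only [Finset.sum_apply, Pi.smul_apply, smul_eq_mul] using congrFun (congrFun (hβ i) x) t
    B_eq := hB
    u_eq := fun n => rfl }⟩

theorem EqOmega.sub {f f' g g' : ℝ → ℝ → ℝ} (hf : EqOmega T f f') (hg : EqOmega T g g') :
    EqOmega T (f - g) (f' - g') :=
  fun x hx t ht => congrArg₂ (· - ·) (hf x hx t ht) (hg x hx t ht)

theorem normW_congr (hT : 0 ≤ T) {f g : ℝ → ℝ → ℝ} (h : EqOmega T f g) :
    normW T f = normW T g := by
  rw [normW, normW, innerW_congr hT h h]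

section Represent

variable {hT : 0 ≤ T}

theorem EqOmega.toFun_sub {f g : ℝ → ℝ → ℝ} {d e : Data T} (hf : EqOmega T f (d.toFun hT))
    (hg : EqOmega T g (e.toFun hT)) : EqOmega T (f - g) ((d - e).toFun hT) := fun x hx t ht => by
  simp only [Pi.sub_apply, hf x hx t ht, hg x hx t ht, Data.toFun, map_sub, ContinuousMap.sub_apply]

theorem EqOmega.toFun_smul {f : ℝ → ℝ → ℝ} {d : Data T} (c : ℝ) (hf : EqOmega T f (d.toFun hT)) :
    EqOmega T (c • f) ((c • d).toFun hT) := fun x hx t ht => by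
  simp only [Pi.smul_apply, hf x hx t ht, Data.toFun, map_smul, ContinuousMap.smul_apply]

theorem EqOmega.toFun_sum_smul {s : Finset ℕ} {f : ℕ → ℝ → ℝ → ℝ} {d : ℕ → Data T} (c : ℕ → ℝ)
    (hf : ∀ i, EqOmega T (f i) ((d i).toFun hT)) :
    EqOmega T (∑ i ∈ s, c i • f i) ((∑ i ∈ s, c i • d i).toFun hT) := fun x hx t ht => by
  simp only [Finset.sum_apply, Pi.smul_apply, fun i => hf i x hx t ht, Data.toFun, map_sum,
    map_smul, ContinuousMap.sum_apply, ContinuousMap.smul_apply]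

theorem tendstoUniformlyOn_toFun {ι : Type*} {l : Filter ι} {y : ι → Data T} {d : Data T}
    (h : Tendsto y l (𝓝 d)) :
    TendstoUniformlyOn (fun n (q : ℝ × ℝ) => (y n).toFun hT q.1 q.2)
      (fun q => d.toFun hT q.1 q.2) l (Omega T) :=
  ContinuousMap.tendsto_iff_forall_isCompact_tendstoUniformlyOn.1
    (((Data.toC hT).continuous.tendsto d).comp h) _ (isCompact_Icc.prod isCompact_Icc)

end Represent

section Embed

variable (hT : 0 < T)

theorem innerW_eq_inner_embed {f g : ℝ → ℝ → ℝ} {d e : Data T} (hf : EqOmega T f (d.toFun hT.le))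
    (hg : EqOmega T g (e.toFun hT.le)) :
    innerW T f g = ⟪Data.embed hT.le d, Data.embed hT.le e⟫_ℝ := by
  rw [innerW_congr hT.le hf hg, Data.inner_embed hT]

theorem normW_eq_norm_embed {f : ℝ → ℝ → ℝ} {d : Data T} (hf : EqOmega T f (d.toFun hT.le)) :
    normW T f = ‖Data.embed hT.le d‖ := by
  rw [normW, innerW_eq_inner_embed hT hf hf, norm_eq_sqrt_real_inner]

theorem EqOmega.embed_eq {f : ℝ → ℝ → ℝ} {d e : Data T} (hd : EqOmega T f (d.toFun hT.le))
    (he : EqOmega T f (e.toFun hT.le)) : Data.embed hT.le d = Data.embed hT.le e := by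
  rw [← sub_eq_zero, ← map_sub, ← norm_eq_zero, ← normW_eq_norm_embed hT (hd.toFun_sub he),
    normW_eq_norm_embed hT (he.toFun_sub he), sub_self, map_zero, norm_zero]

theorem tendsto_normW_of_tendsto_data {ι : Type*} {l : Filter ι} {f : ι → ℝ → ℝ → ℝ}
    {y : ι → Data T} (hf : ∀ n, EqOmega T (f n) ((y n).toFun hT.le)) (hy : Tendsto y l (𝓝 0)) :
    Tendsto (fun n => normW T (f n)) l (𝓝 0) := by
  simp only [fun n => normW_eq_norm_embed hT (hf n)]
  simpa using (((Data.embed hT.le).continuous.tendsto 0).comp hy).norm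

theorem Data.waveC_apply_corner (d : Data T) {x : ℝ} (hx : x = 0 ∨ x = 1) :
    waveC hT.le d (x, 0) = 0 := by
  change SineGordon.greenC (prim hT.le d) (x, 0) - SineGordon.primTC _ (x, 0) = 0
  rcases hx with rfl | rfl
  · rw [primTC_zero, greenC_zero, sub_zero]
  · rw [primTC_zero, greenC_one, sub_zero]

end Embed

theorem IsSolution.rhs_corner_eq_zero (hT : 0 < T) {v : ℝ → ℝ → ℝ} (hv : IsSolution T M v)
    {x : ℝ} (hx : x = 0 ∨ x = 1) : M x 0 0 = 0 := by
  have hxI : x ∈ Icc (0 : ℝ) 1 := by rcases hx with rfl | rfl <;> simp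
  have h0 : (0 : ℝ) ∈ Icc 0 T := left_mem_Icc.2 hT.le
  obtain ⟨d, hd⟩ := hv.1.exists_data hT
  calc M x 0 0 = M x 0 (v x 0) := by rw [(hv.1.initial x hxI).1]
    _ = waveOp T v x 0 := (hv.2 x hxI 0 h0).symm
    _ = Data.waveC hT.le d (x, 0) := by rw [hd.waveOp x hxI 0 h0, Data.waveC_apply hT d hxI h0]
    _ = 0 := d.waveC_apply_corner hT hx

namespace Scheme

variable (hT : 0 < T) (S : Scheme T M p)

/-- Data that represent the function `Ψ_i` of a scheme. -/
noncomputable def data (i : ℕ) : Data T := ((S.adjoint_eq i).1.exists_data hT).choose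

theorem eqOmega_Ψ (i : ℕ) : EqOmega T (S.Ψ i) ((S.data hT i).toFun hT.le) :=
  ((S.adjoint_eq i).1.exists_data hT).choose_spec

/-- Data that represent the function `Ψ̂_i` of a scheme. -/
noncomputable def hatData (i : ℕ) : Data T :=
  ∑ k ∈ Finset.range (i + 1), S.β i k • S.data hT k

theorem eqOmega_Ψhat (i : ℕ) : EqOmega T (S.Ψhat i) ((S.hatData hT i).toFun hT.le) :=
  fun x hx t ht => by
    rw [S.coeff_eq i x hx t ht]
    simpa only [hatData, Finset.sum_apply, Pi.smul_apply, smul_eq_mul] using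
      EqOmega.toFun_sum_smul (s := Finset.range (i + 1)) (S.β i) (S.eqOmega_Ψ hT) x hx t ht

theorem eqOmega_sum (s : Finset ℕ) : EqOmega T (∑ i ∈ s, S.B i • S.Ψhat i)
    ((∑ i ∈ s, S.B i • S.hatData hT i).toFun hT.le) :=
  EqOmega.toFun_sum_smul S.B (S.eqOmega_Ψhat hT)

theorem eqOmega_u (n : ℕ) : EqOmega T (S.u n)
    ((∑ i ∈ Finset.range n, S.B i • S.hatData hT i).toFun hT.le) :=
  S.u_eq n ▸ S.eqOmega_sum hT _

theorem inner_data (hp : ∀ i, p i ∈ Omega T) (i : ℕ) (d : Data T) :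
    ⟪Data.embed hT.le d, Data.embed hT.le (S.data hT i)⟫_ℝ = Data.waveC hT.le d (p i) := by
  rw [← innerW_eq_inner_embed hT (.refl _) (S.eqOmega_Ψ hT i),
    (S.adjoint_eq i).innerW_eq hT (hp i) (Data.memW_toFun hT d),
    ← Data.waveC_apply hT d (hp i).1 (hp i).2]

theorem inner_hatData (hp : ∀ i, p i ∈ Omega T) (i : ℕ) (d : Data T) :
    ⟪Data.embed hT.le d, Data.embed hT.le (S.hatData hT i)⟫_ℝ =
      ∑ k ∈ Finset.range (i + 1), S.β i k * Data.waveC hT.le d (p k) := by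
  simp only [hatData, map_sum, map_smul, inner_sum, real_inner_smul_right, S.inner_data hT hp]

theorem embed_hatData : (fun i => Data.embed hT.le (S.hatData hT i)) =
    InnerProductSpace.gramSchmidtNormed ℝ fun i => Data.embed hT.le (S.data hT i) := by
  refine eq_gramSchmidtNormed fun i => ?_
  have hres : EqOmega T (residual T S.Ψ S.Ψhat i)
      ((S.data hT i - ∑ k ∈ Finset.range i,
        innerW T (S.Ψ i) (S.Ψhat k) • S.hatData hT k).toFun hT.le) :=
    (S.eqOmega_Ψ hT i).toFun_sub (EqOmega.toFun_sum_smul _ (S.eqOmega_Ψhat hT))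
  have hhat := hres.toFun_smul (normW T (residual T S.Ψ S.Ψhat i))⁻¹
  rw [← S.gramSchmidt_eq i] at hhat
  rw [EqOmega.embed_eq hT (S.eqOmega_Ψhat hT i) hhat, normW_eq_norm_embed hT hres]
  simp only [map_smul, map_sub, map_sum,
    fun k => innerW_eq_inner_embed hT (S.eqOmega_Ψ hT i) (S.eqOmega_Ψhat hT k)]

end Scheme

/-! ### Convergence -/

namespace Scheme

section Limit

variable (hT : 0 < T) (S : Scheme T M p)

theorem inner_hatData_of_ne {i k : ℕ} (h : i ≠ k) :
    ⟪Data.embed hT.le (S.hatData hT i), Data.embed hT.le (S.hatData hT k)⟫_ℝ = 0 := by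
  simpa only [← S.embed_hatData hT] using
    inner_gramSchmidtNormed_of_ne (fun i => Data.embed hT.le (S.data hT i)) h

theorem summable_data {C : ℝ} (hC : ∀ n, normW T (S.u n) ≤ C) :
    Summable fun i => S.B i • S.hatData hT i := by
  refine summable_of_antilipschitz (Data.antilipschitz_embed hT.le) ?_
  simp only [map_smul]
  refine summable_of_pairwise_orthogonal (C := C) (fun i k hik => ?_) fun n => ?_
  · simp only [real_inner_smul_left, real_inner_smul_right, S.inner_hatData_of_ne hT hik, mul_zero]
  · simpa only [normW_eq_norm_embed hT (S.eqOmega_u hT n), map_sum, map_smul] using hC n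

theorem nondegenerate (hp : ∀ i, p i ∈ Omega T) (hinj : Function.Injective p) {i : ℕ}
    (hi₀ : p i ≠ (0, 0)) (hi₁ : p i ≠ (1, 0)) :
    ‖Data.embed hT.le (S.hatData hT i)‖ = 1 ∧ S.β i i ≠ 0 := by
  obtain ⟨w, hwi, hw⟩ := exists_data_separating hT (hp i) hi₀ hi₁ ((finite_Iio i).image p)
    (image_subset_iff.2 fun k _ => hp k) fun ⟨k, hk, hki⟩ => (mem_Iio.1 hk).ne (hinj hki)
  have hlt : ∀ k < i, Data.waveC hT.le w (p k) = 0 := fun k hk => hw _ ⟨k, hk, rfl⟩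
  have hβ : ⟪Data.embed hT.le w, Data.embed hT.le (S.hatData hT i)⟫_ℝ =
      S.β i i * Data.waveC hT.le w (p i) := by
    rw [S.inner_hatData hT hp, Finset.sum_range_succ, Finset.sum_eq_zero, zero_add]
    intro k hk
    rw [hlt k (Finset.mem_range.1 hk), mul_zero]
  have hne : ⟪Data.embed hT.le w, Data.embed hT.le (S.hatData hT i)⟫_ℝ ≠ 0 := by
    rw [congrFun (S.embed_hatData hT) i]
    refine inner_gramSchmidtNormed_ne_zero (fun k hk => ?_) ?_
    · rw [S.inner_data hT hp, hlt k hk]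
    · rwa [S.inner_data hT hp]
  refine ⟨?_, left_ne_zero_of_mul (hβ ▸ hne)⟩
  have hhat : Data.embed hT.le (S.hatData hT i) ≠ 0 := fun h => hne (by rw [h, inner_zero_right])
  rw [congrFun (S.embed_hatData hT) i] at hhat ⊢
  exact InnerProductSpace.gramSchmidtNormed_unit_length' hhat

theorem inner_hasSum {d : Data T} (hd : HasSum (fun i => S.B i • S.hatData hT i) d) (i : ℕ) :
    ⟪Data.embed hT.le d, Data.embed hT.le (S.hatData hT i)⟫_ℝ =
      S.B i * ‖Data.embed hT.le (S.hatData hT i)‖ ^ 2 := by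
  have hinner := (hd.mapL (Data.embed hT.le)).mapL (innerSL ℝ (Data.embed hT.le (S.hatData hT i)))
  have hsingle := hinner.unique (hasSum_single i fun k hk => by
    rw [innerSL_apply_apply, map_smul, real_inner_smul_right, S.inner_hatData_of_ne hT hk.symm,
      mul_zero])
  rw [innerSL_apply_apply, innerSL_apply_apply, map_smul, real_inner_smul_right,
    real_inner_self_eq_norm_sq] at hsingle
  rw [real_inner_comm, hsingle]

theorem waveC_eq_at_corner (hp : ∀ i, p i ∈ Omega T) (d : Data T) {i : ℕ} {x : ℝ}
    (hx : x = 0 ∨ x = 1) (hM : M x 0 0 = 0) (hi : p i = (x, 0)) :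
    Data.waveC hT.le d (p i) = M (p i).1 (p i).2 (S.u i (p i).1 (p i).2) := by
  have hu := ((Data.memW_toFun hT (∑ k ∈ Finset.range i, S.B k • S.hatData hT k)).initial _
    (hp i).1).1
  rw [S.eqOmega_u hT i _ (hp i).1 _ (hp i).2]
  simp only [hi] at hu ⊢
  rw [hu, hM, d.waveC_apply_corner hT hx]

theorem waveC_eq_at_points (hp : ∀ i, p i ∈ Omega T) (hinj : Function.Injective p)
    (hM₀ : M 0 0 0 = 0) (hM₁ : M 1 0 0 = 0) {d : Data T}
    (hd : HasSum (fun i => S.B i • S.hatData hT i) d) (i : ℕ) :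
    Data.waveC hT.le d (p i) = M (p i).1 (p i).2 (S.u i (p i).1 (p i).2) := by
  induction i using Nat.strong_induction_on with
  | _ i ih =>
    by_cases hi₀ : p i = (0, 0)
    · exact S.waveC_eq_at_corner hT hp d (.inl rfl) hM₀ hi₀
    by_cases hi₁ : p i = (1, 0)
    · exact S.waveC_eq_at_corner hT hp d (.inr rfl) hM₁ hi₁
    obtain ⟨hnorm, hβ⟩ := S.nondegenerate hT hp hinj hi₀ hi₁
    have hB := S.inner_hasSum hT hd i
    rw [hnorm, one_pow, mul_one, S.inner_hatData hT hp, S.B_eq, Finset.sum_range_succ,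
      Finset.sum_range_succ, Finset.sum_congr rfl fun k hk => by
        rw [ih k (Finset.mem_range.1 hk)]] at hB
    exact mul_left_cancel₀ hβ (add_left_cancel hB)

theorem tendstoUniformlyOn_u {d : Data T} (hd : HasSum (fun i => S.B i • S.hatData hT i) d) :
    TendstoUniformlyOn (fun n (q : ℝ × ℝ) => S.u n q.1 q.2) (fun q => d.toFun hT.le q.1 q.2)
      atTop (Omega T) :=
  (tendstoUniformlyOn_toFun hd.tendsto_sum_nat).congr
    (.of_forall fun n q hq => (S.eqOmega_u hT n q.1 hq.1 q.2 hq.2).symm)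

theorem isSolution_of_hasSum (hM : ContinuousOn (fun q : ℝ × ℝ × ℝ => M q.1 q.2.1 q.2.2)
      (Icc (0 : ℝ) 1 ×ˢ Icc (0 : ℝ) T ×ˢ (univ : Set ℝ)))
    (hM₀ : M 0 0 0 = 0) (hM₁ : M 1 0 0 = 0) (hp : ∀ i, p i ∈ Omega T)
    (hinj : Function.Injective p) (hdense : Omega T ⊆ closure (range p)) {d : Data T}
    (hd : HasSum (fun i => S.B i • S.hatData hT i) d) : IsSolution T M (d.toFun hT.le) := by
  refine ⟨Data.memW_toFun hT d, fun x hx t ht => ?_⟩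
  obtain ⟨U, hU, hpU⟩ := mapClusterPt_iff_ultrafilter.1
    (mapClusterPt_of_dense hT hdense (q := (x, t)) ⟨hx, ht⟩)
  have hunif : TendstoUniformlyOn (fun n (q : ℝ × ℝ) => S.u n q.1 q.2)
      (fun q => d.toFun hT.le q.1 q.2) U (Omega T) :=
    fun V hV => hU (S.tendstoUniformlyOn_u hT hd V hV)
  have hu : Tendsto (fun n => S.u n (p n).1 (p n).2) U (𝓝 (d.toFun hT.le x t)) :=
    hunif.tendsto_comp (g := p) (x := (x, t)) (Data.toC hT.le d).continuous.continuousWithinAt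
      (tendsto_nhdsWithin_iff.2 ⟨hpU, .of_forall hp⟩)
  have hrhs : Tendsto (fun n => M (p n).1 (p n).2 (S.u n (p n).1 (p n).2)) U
      (𝓝 (M x t (d.toFun hT.le x t))) :=
    (hM (x, t, d.toFun hT.le x t) ⟨hx, ht, trivial⟩).tendsto.comp <| tendsto_nhdsWithin_iff.2
      ⟨hpU.fst_nhds.prodMk_nhds (hpU.snd_nhds.prodMk_nhds hu),
        .of_forall fun n => ⟨(hp n).1, (hp n).2, trivial⟩⟩
  have hlhs : Tendsto (fun n => Data.waveC hT.le d (p n)) U (𝓝 (Data.waveC hT.le d (x, t))) :=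
    ((Data.waveC hT.le d).continuous.tendsto (x, t)).comp hpU
  rw [← Data.waveC_apply hT d hx ht]
  refine tendsto_nhds_unique hlhs (hrhs.congr fun n => ?_)
  exact (S.waveC_eq_at_points hT hp hinj hM₀ hM₁ hd n).symm

end Limit

/-- Convergence of the iterates and of the series of a scheme to `v`: in the norm of `W(Ω)` and
uniformly for the iterates, unconditionally in `W(Ω)` and at each point for the series. -/
structure ConvergesTo (S : Scheme T M p) (v : ℝ → ℝ → ℝ) : Prop where
  tendsto_normW_u : Tendsto (fun n => normW T (S.u n - v)) atTop (𝓝 0)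
  tendstoUniformlyOn_u : TendstoUniformlyOn (fun n (q : ℝ × ℝ) => S.u n q.1 q.2)
    (fun q => v q.1 q.2) atTop (Omega T)
  tendsto_normW_sum : Tendsto (fun s : Finset ℕ => normW T (v - ∑ i ∈ s, S.B i • S.Ψhat i))
    atTop (𝓝 0)
  hasSum : ∀ x ∈ Icc (0 : ℝ) 1, ∀ t ∈ Icc (0 : ℝ) T,
    HasSum (fun i => S.B i * S.Ψhat i x t) (v x t)

theorem convergesTo_of_hasSum (hT : 0 < T) {S : Scheme T M p} {d : Data T}
    (hd : HasSum (fun i => S.B i • S.hatData hT i) d) {v : ℝ → ℝ → ℝ}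
    (hv : EqOmega T v (d.toFun hT.le)) : S.ConvergesTo v where
  tendsto_normW_u := tendsto_normW_of_tendsto_data hT
    (fun n => (S.eqOmega_u hT n).toFun_sub hv) (by simpa using hd.tendsto_sum_nat.sub_const d)
  tendstoUniformlyOn_u := (S.tendstoUniformlyOn_u hT hd).congr_right
    fun q hq => (hv q.1 hq.1 q.2 hq.2).symm
  tendsto_normW_sum := tendsto_normW_of_tendsto_data hT
    (fun s => hv.toFun_sub (S.eqOmega_sum hT s)) (by simpa using Tendsto.const_sub d hd)
  hasSum x hx t ht := by
    have hsum := (hd.mapL (Data.toC hT.le)).mapL (ContinuousMap.evalCLM ℝ (x, t))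
    rw [hv x hx t ht]
    refine hsum.congr_fun fun i => ?_
    rw [S.eqOmega_Ψhat hT i x hx t ht, map_smul]
    rfl

theorem ConvergesTo.congr (hT : 0 ≤ T) {S : Scheme T M p} {v w : ℝ → ℝ → ℝ}
    (hv : S.ConvergesTo v) (h : EqOmega T v w) : S.ConvergesTo w where
  tendsto_normW_u := hv.tendsto_normW_u.congr fun n =>
    normW_congr hT ((EqOmega.refl (S.u n)).sub h)
  tendstoUniformlyOn_u := hv.tendstoUniformlyOn_u.congr_right fun q hq => h q.1 hq.1 q.2 hq.2
  tendsto_normW_sum := hv.tendsto_normW_sum.congr fun s =>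
    normW_congr hT (h.sub (.refl (∑ i ∈ s, S.B i • S.Ψhat i)))
  hasSum x hx t ht := h x hx t ht ▸ hv.hasSum x hx t ht

end Scheme

end SineGordon

theorem theorem4p1_general (T : ℝ) (hT : 0 < T) (M : ℝ → ℝ → ℝ → ℝ)
    (hM : ContinuousOn (fun q : ℝ × ℝ × ℝ => M q.1 q.2.1 q.2.2)
      (Icc (0 : ℝ) 1 ×ˢ Icc (0 : ℝ) T ×ˢ (univ : Set ℝ)))
    (hM₀ : M 0 0 0 = 0) (hM₁ : M 1 0 0 = 0)
    (p : ℕ → ℝ × ℝ) (hp : ∀ i, p i ∈ SineGordon.Omega T) (hinj : Function.Injective p)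
    (hdense : SineGordon.Omega T ⊆ closure (range p)) :
    (∀ w, SineGordon.MemW T w → SineGordon.MemHatW T (SineGordon.waveOp T w)) ∧
    Nonempty (SineGordon.Scheme T M p) ∧
    ∀ S : SineGordon.Scheme T M p, (∃ C : ℝ, ∀ n, SineGordon.normW T (S.u n) ≤ C) →
      ∃ v, SineGordon.IsSolution T M v ∧ S.ConvergesTo v := by
  refine ⟨fun w hw => SineGordon.memHatW_waveOp hT hw, SineGordon.nonempty_scheme hT M hp,
    fun S ⟨C, hC⟩ => ?_⟩
  obtain ⟨d, hd⟩ := S.summable_data hT hC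
  exact ⟨d.toFun hT.le, S.isSolution_of_hasSum hT hM hM₀ hM₁ hp hinj hdense hd,
    SineGordon.Scheme.convergesTo_of_hasSum hT hd (.refl _)⟩

theorem theorem4p1 (T : ℝ) (hT : 0 < T)
    (M : ℝ → ℝ → ℝ → ℝ)
    (hM : ContinuousOn (fun q : ℝ × ℝ × ℝ => M q.1 q.2.1 q.2.2)
      (Icc (0 : ℝ) 1 ×ˢ Icc (0 : ℝ) T ×ˢ (univ : Set ℝ)))
    (p : ℕ → ℝ × ℝ) (hp : ∀ i, p i ∈ SineGordon.Omega T) (hinj : Function.Injective p)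
    (hdense : SineGordon.Omega T ⊆ closure (range p))
    (v : ℝ → ℝ → ℝ) (hv : SineGordon.IsSolution T M v)
    (huniq : ∀ w, SineGordon.IsSolution T M w →
      ∀ x ∈ Icc (0 : ℝ) 1, ∀ t ∈ Icc (0 : ℝ) T, w x t = v x t) :
    -- the method is well defined: `L` maps `W(Ω)` to `Ŵ(Ω)`, and all its objects exist
    (∀ w, SineGordon.MemW T w → SineGordon.MemHatW T (SineGordon.waveOp T w)) ∧
    Nonempty (SineGordon.Scheme T M p) ∧
    -- if the iterates are bounded, they converge to the solution, which is the sum of the series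
    ∀ S : SineGordon.Scheme T M p, (∃ C : ℝ, ∀ n, SineGordon.normW T (S.u n) ≤ C) →
      Tendsto (fun n => SineGordon.normW T (S.u n - v)) atTop (𝓝 0) ∧
      TendstoUniformlyOn (fun n (q : ℝ × ℝ) => S.u n q.1 q.2) (fun q => v q.1 q.2) atTop
        (SineGordon.Omega T) ∧
      Tendsto (fun s : Finset ℕ => SineGordon.normW T (v - ∑ i ∈ s, S.B i • S.Ψhat i))
        atTop (𝓝 0) ∧
      ∀ x ∈ Icc (0 : ℝ) 1, ∀ t ∈ Icc (0 : ℝ) T, HasSum (fun i => S.B i * S.Ψhat i x t) (v x t) := by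
  obtain ⟨hL, hS, hconv⟩ := theorem4p1_general T hT M hM (hv.rhs_corner_eq_zero hT (.inl rfl))
    (hv.rhs_corner_eq_zero hT (.inr rfl)) p hp hinj hdense
  refine ⟨hL, hS, fun S hC => ?_⟩
  obtain ⟨w, hw, hSw⟩ := hconv S hC
  have ⟨hu, hunif, hsum, hpt⟩ := hSw.congr hT.le (huniq w hw)
  exact ⟨hu, hunif, hsum, hpt⟩
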